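/- Theorem 1.3. Let $\{\xi(t),t\ge 0\}$ be a real-valued Lévy process (that is, $\xi(0)=0$ a.s., with stationary independent increments and càdlàg paths) such that $\psi(u):=\log\mathbb E\,e^{u\xi(1)}$ is finite for all $u\in\mathbb R$ and $\xi(1)$ is not a.s. constant. Let $\xi_1,\xi_2,\dots$ be independent copies of $\xi$, let $(s_N)_{N\in\mathbb N}$ be a sequence of non-negative reals, and put $$Z_N(t)=\sum_{i=1}^{N}e^{\xi_i(s_N+t)},\qquad t\ge -s_N,\qquad\qquad \lambda_2=2\psi'(2)-\psi(2).$$ Assume critical growth: for some $\vartheta\in\mathbb R$, $$\log N=\lambda_2 s_N+2\vartheta\sqrt{\psi''(2)s_N}+o(\sqrt{s_N}),\qquad N\to\infty$$ (this forces $s_N\to\infty$). Then, as $N\to\infty$, the process $$\frac{Z_N(t)-\mathbb E Z_N(t)}{\sqrt{\operatorname{Var}Z_N(t)}},\qquad t\in\mathbb R$$ (for each fixed $t$ well defined for all sufficiently large $N$), converges in the sense of weak convergence of all finite-dimensional distributions to $\{\sqrt{\Phi(\vartheta)}\,\mathcal X(t),\ t\in\mathbb R\}$, where $\Phi$ is the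 standard normal distribution function and $\mathcal X$ is the Ornstein–Uhlenbeck process, i.e. the zero-mean Gaussian process with $$\operatorname{Cov}(\mathcal X(t_1),\mathcal X(t_2))=e^{(\psi(1)-\psi(2)/2)\,|t_2-t_1|},\qquad t_1,t_2\in\mathbb R.$$ -/

import Mathlib

open MeasureTheory ProbabilityTheory Filter Topology Asymptotics
open scoped NNReal

/-- A function `f : [0, ∞) → ℝ` is càdlàg: it is right-continuous everywhere and has a finite
left limit at every point (at `0` the left-limit condition is void, as it should be). -/
def IsCadlag (f : ℝ≥0 → ℝ) : Prop :=
  ∀ t : ℝ≥0, ContinuousWithinAt f (Set.Ici t) t ∧ ∃ l : ℝ, Tendsto f (𝓝[<] t) (𝓝 l)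

/-- A real-valued Lévy process `{ξ(t), t ≥ 0}` on a probability space `(Ω, P)`: a process that
starts at `0`, has stationary and independent increments and (almost surely) càdlàg paths. -/
structure IsLevyProcess {Ω : Type*} [MeasurableSpace Ω] (ξ : ℝ≥0 → Ω → ℝ) (P : Measure Ω) :
    Prop where
  measurable : ∀ t, Measurable (ξ t)
  zero : ξ 0 =ᵐ[P] 0
  indep : HasIndepIncrements ξ P
  stationary : ∀ t h : ℝ≥0, IdentDistrib (fun ω ↦ ξ (t + h) ω - ξ t ω) (ξ h) P P
  cadlag : ∀ᵐ ω ∂P, IsCadlag fun t ↦ ξ t ω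

/-- `ξ₁, ξ₂, …` (indexed here by `0, 1, …`) are independent copies of the process `ξ`: each of
them has the same law as `ξ`, as a random element of `ℝ^[0, ∞)`, and they are independent. -/
structure AreIndepCopies {Ω Ω₀ : Type*} [MeasurableSpace Ω] [MeasurableSpace Ω₀]
    (ξs : ℕ → ℝ≥0 → Ω → ℝ) (P : Measure Ω) (ξ : ℝ≥0 → Ω₀ → ℝ) (P₀ : Measure Ω₀) : Prop where
  identDistrib : ∀ i, IdentDistrib (fun ω t ↦ ξs i t ω) (fun ω t ↦ ξ t ω) P P₀
  indep : iIndepFun (fun i ω t ↦ ξs i t ω) P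

/-- The logarithmic moment generating function `ψ(u) = log 𝔼 exp(u ξ(1))`. -/
noncomputable def psi {Ω : Type*} [MeasurableSpace Ω] (ξ : ℝ≥0 → Ω → ℝ) (P : Measure Ω)
    (u : ℝ) : ℝ :=
  Real.log (∫ ω, Real.exp (u * ξ 1 ω) ∂P)

/-- The critical point `λ₂ = 2 ψ'(2) - ψ(2)`. -/
noncomputable def lambdaTwo {Ω : Type*} [MeasurableSpace Ω] (ξ : ℝ≥0 → Ω → ℝ)
    (P : Measure Ω) : ℝ :=
  2 * deriv (psi ξ P) 2 - psi ξ P 2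

/-- The sum `Z_N(t) = ∑_{i ≤ N} exp(ξ_i(s_N + t))`, for a real time `t`. It is only meaningful
for `t ≥ -s_N`; for earlier `t` the time `s_N + t` is replaced by `0`. -/
noncomputable def sumProcess {Ω : Type*} (ξs : ℕ → ℝ≥0 → Ω → ℝ) (s : ℕ → ℝ) (N : ℕ) (t : ℝ)
    (ω : Ω) : ℝ :=
  ∑ i ∈ Finset.range N, Real.exp (ξs i (s N + t).toNNReal ω)

/-- The normalization `(Y(t) - 𝔼 Y(t)) / √(Var Y(t))` of a process `Y`. -/
noncomputable def normalized {Ω : Type*} [MeasurableSpace Ω] (Y : ℝ → Ω → ℝ) (P : Measure Ω)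
    (t : ℝ) (ω : Ω) : ℝ :=
  (Y t ω - ∫ ω', Y t ω' ∂P) / √(variance (Y t) P)

/-- `X` is a zero-mean Gaussian process on `ℝ` with `Cov(X(t₁), X(t₂)) = exp(-c |t₂ - t₁|)`, that
is, a (two-sided, stationary) Ornstein–Uhlenbeck process. -/
structure IsOrnsteinUhlenbeck {Ω : Type*} [MeasurableSpace Ω] (c : ℝ) (X : ℝ → Ω → ℝ)
    (P : Measure Ω) : Prop where
  gaussian : IsGaussianProcess X P
  mean : ∀ t, ∫ ω, X t ω ∂P = 0
  cov : ∀ t₁ t₂, covariance (X t₁) (X t₂) P = Real.exp (-c * |t₂ - t₁|)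

/-- The isonormal Gaussian process of a real Hilbert space `H`. -/
theorem isonormal {H : Type} [NormedAddCommGroup H] [InnerProductSpace ℝ H] [CompleteSpace H] :
    ∃ (Ω : Type) (_ : MeasurableSpace Ω) (P : Measure Ω) (_ : IsProbabilityMeasure P)
      (Φ : H →ₗᵢ[ℝ] Lp ℝ 2 P), ∀ h, P.map (Φ h) = gaussianReal 0 (‖h‖₊ ^ 2) := by
  classical
  obtain ⟨w, b, -⟩ := exists_hilbertBasis ℝ H
  let P : Measure (w → ℝ) := Measure.infinitePi fun _ ↦ gaussianReal 0 1
  have hlaw (i : w) : HasLaw (fun x : w → ℝ ↦ x i) (gaussianReal 0 1) P :=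
    (measurePreserving_eval_infinitePi (fun _ : w ↦ gaussianReal 0 1) i).hasLaw
  have hind : iIndepFun (fun (i : w) (x : w → ℝ) ↦ x i) P :=
    iIndepFun_infinitePi (P := fun _ : w ↦ gaussianReal 0 1) (X := fun _ x ↦ x)
      fun _ ↦ measurable_id
  have hmem (i : w) : MemLp (fun x : w → ℝ ↦ x i) 2 P := (hlaw i).hasGaussianLaw.memLp_two
  have hmean (i : w) : ∫ x, x i ∂P = 0 := by
    rw [(hlaw i).integral_eq, integral_id_gaussianReal]
  let g (i : w) : Lp ℝ 2 P := (hmem i).toLp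
  have hinner (i j : w) : inner ℝ (g i) (g j) = ∫ x, x j * x i ∂P := by
    rw [L2.inner_def]
    refine integral_congr_ae ?_
    filter_upwards [(hmem i).coeFn_toLp, (hmem j).coeFn_toLp] with x h1 h2
    simp only [g, h1, h2]; simp
  have hon : Orthonormal ℝ g := by
    rw [orthonormal_iff_ite]
    intro i j
    rw [hinner]
    split_ifs with h
    · subst h
      have h1 := (hlaw i).variance_eq
      rw [variance_id_gaussianReal, variance_eq_sub (hmem i), hmean] at h1
      simpa [sq] using h1
    · have := (hind.indepFun (Ne.symm h)).integral_mul_eq_mul_integral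
        (hmem j).aestronglyMeasurable (hmem i).aestronglyMeasurable
      simpa [hmean] using this
  have hV := hon.orthogonalFamily
  obtain ⟨Φ, hΦ⟩ : ∃ Φ : H →ₗᵢ[ℝ] Lp ℝ 2 P, ∀ i, Φ (b i) = g i := by
    refine ⟨hV.linearIsometry.comp b.repr.toLinearIsometry, fun i ↦ ?_⟩
    have h1 : hV.linearIsometry (b.repr (b i)) = g i := by
      rw [HilbertBasis.repr_self, OrthogonalFamily.linearIsometry_apply_single]
      simp
    exact h1
  refine ⟨w → ℝ, inferInstance, P, inferInstance, Φ, ?_⟩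
  have hclosed : IsClosed {h : H | P.map (Φ h) = gaussianReal 0 (‖h‖₊ ^ 2)} := by
    refine IsSeqClosed.isClosed fun h h₀ hh hlim ↦ ?_
    have hm (h : H) : AEMeasurable (Φ h) P := (Lp.aestronglyMeasurable _).aemeasurable
    have h1 := (tendstoInMeasure_of_tendsto_Lp ((Φ.continuous.tendsto h₀).comp hlim)).tendstoInDistribution
      (fun n ↦ hm _)
    have := Measure.isProbabilityMeasure_map (hm h₀)
    refine Measure.ext_of_charFun (funext fun t ↦ ?_)
    have h2 := (ProbabilityMeasure.tendsto_iff_tendsto_charFun.1 h1.tendsto) t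
    refine tendsto_nhds_unique h2 ?_
    have h3 (n : ℕ) : charFun (P.map (Φ (h n))) t = charFun (gaussianReal 0 (‖h n‖₊ ^ 2)) t := by
      rw [hh n]
    simp only [ProbabilityMeasure.coe_mk, Function.comp_apply, h3, charFun_gaussianReal]
    have : Tendsto (fun n ↦ ‖h n‖₊) atTop (𝓝 ‖h₀‖₊) := hlim.nnnorm
    have h4 : Continuous fun r : ℝ≥0 ↦
      Complex.exp (t * (0 : ℝ) * Complex.I - ((r ^ 2 : ℝ≥0) : ℝ) * t ^ 2 / 2) := by fun_prop
    exact (h4.tendsto _).comp this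
  intro h
  refine hclosed.mem_of_tendsto (b.hasSum_repr h) (Eventually.of_forall fun S ↦ ?_)
  generalize hr : (fun i ↦ (b.repr h : w → ℝ) i) = r
  have hr' (i : w) : (b.repr h : w → ℝ) i = r i := by rw [← hr]
  simp only [hr', Set.mem_ofPred_eq]
  set f := Φ (∑ i ∈ S, r i • b i) with hf
  have hae : f =ᵐ[P] fun x ↦ ∑ i : S, r i * x i := by
    have h1 : f = ∑ i : S, r i • g i := by
      rw [hf, map_sum, ← Finset.sum_coe_sort]
      exact Finset.sum_congr rfl fun i _ ↦ by rw [map_smul, hΦ]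
    have h2 : ∀ᵐ x ∂P, ∀ i : S, (r i • g i : Lp ℝ 2 P) x = r i * x i := by
      refine ae_all_iff.2 fun i ↦ ?_
      filter_upwards [Lp.coeFn_smul (r i) (g i), (hmem i).coeFn_toLp] with x h3 h4
      simp only [h3, Pi.smul_apply, smul_eq_mul, g, h4]
    rw [h1]
    filter_upwards [Lp.coeFn_finsetSum Finset.univ fun i : S ↦ r i • g i, h2] with x h3 h4
    rw [h3, Finset.sum_apply]
    exact Finset.sum_congr rfl fun i _ ↦ h4 i
  have hG : HasGaussianLaw (fun x : w → ℝ ↦ ∑ i : S, r i * x i) P := by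
    refine iIndepFun.hasGaussianLaw_fun_sum
      (fun i ↦ (hlaw i).hasGaussianLaw.fun_smul (r i)) ?_
    exact (hind.precomp (g := fun i : S ↦ (i : w)) Subtype.val_injective).comp
      (fun i x ↦ r i * x) (fun i ↦ by fun_prop)
  have hGf : HasGaussianLaw f P := hG.congr hae.symm
  have hm0 : ∫ x, f x ∂P = 0 := by
    rw [integral_congr_ae hae, integral_finsetSum (f := fun (i : S) (x : w → ℝ) ↦ r i * x i) _
      fun i _ ↦ ((hmem i).integrable (by norm_num)).const_mul _]
    simp [integral_const_mul, hmean]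
  have hv : Var[f; P] = ‖f‖ ^ 2 := by
    rw [variance_eq_sub (Lp.memLp f), hm0, ← real_inner_self_eq_norm_sq, L2.inner_def]
    simp [sq]
  rw [hGf.map_eq_gaussianReal, hm0, hv, hf, Φ.norm_map]
  congr 1
  ext
  simp

/-- Ornstein–Uhlenbeck processes exist. -/
theorem exists_isOrnsteinUhlenbeck {c : ℝ} (hc : 0 < c) :
    ∃ (Ω : Type) (_ : MeasurableSpace Ω) (P : Measure Ω) (_ : IsProbabilityMeasure P)
      (X : ℝ → Ω → ℝ), IsOrnsteinUhlenbeck c X P := by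
  obtain ⟨Ω, _, P, _, Φ, hΦ⟩ := isonormal (H := Lp ℝ 2 (volume : Measure ℝ))
  let k (t : ℝ) : ℝ → ℝ := (Set.Iic t).indicator fun x ↦ √(2 * c) * Real.exp (c * (x - t))
  have hprod (s t x : ℝ) : k s x * k t x = (Set.Iic (min s t)).indicator
      (fun x ↦ (2 * c) * Real.exp (-c * (s + t)) * Real.exp (2 * c * x)) x := by
    by_cases hs : x ≤ s <;> by_cases ht : x ≤ t <;> simp [k, hs, ht]
    have h1 := Real.mul_self_sqrt (by positivity : 0 ≤ 2 * c)
    rw [Real.sqrt_mul (by norm_num)] at h1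
    calc _ = (√2 * √c * (√2 * √c)) * (Real.exp (c * (x - s)) * Real.exp (c * (x - t))) := by ring
      _ = _ := by rw [h1, ← Real.exp_add, mul_assoc (2 * c), ← Real.exp_add]; ring_nf
  have hmeas (t : ℝ) : Measurable (k t) :=
    Measurable.indicator (by fun_prop) measurableSet_Iic
  have hint (s t : ℝ) : ∫ x, k s x * k t x = Real.exp (-c * |t - s|) := by
    simp_rw [hprod]
    rw [integral_indicator measurableSet_Iic, integral_const_mul,
      integral_exp_mul_Iic (by positivity)]
    field_simp
    rw [← Real.exp_add]
    congr 1
    rcases le_total s t with h | h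
    · rw [min_eq_left h, abs_of_nonneg (by linarith)]; ring
    · rw [min_eq_right h, abs_of_nonpos (by linarith)]; ring
  have hmem (t : ℝ) : MemLp (k t) 2 := by
    rw [memLp_two_iff_integrable_sq (hmeas t).aestronglyMeasurable]
    simp_rw [sq, hprod]
    exact (integrable_indicator_iff measurableSet_Iic).2
      ((integrableOn_exp_mul_Iic (by positivity) _).const_mul _)
  let f (t : ℝ) : Lp ℝ 2 (volume : Measure ℝ) := (hmem t).toLp
  have hf (s t : ℝ) : inner ℝ (f s) (f t) = Real.exp (-c * |t - s|) := by
    rw [L2.inner_def, ← hint]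
    refine integral_congr_ae ?_
    filter_upwards [(hmem s).coeFn_toLp, (hmem t).coeFn_toLp] with x h1 h2
    simp only [f, h1, h2]
    simp [mul_comm]
  have haem (g) : AEMeasurable (Φ g) P := (Lp.aestronglyMeasurable _).aemeasurable
  have hmean (g) : ∫ ω, Φ g ω ∂P = 0 := by
    rw [← integral_map (f := fun x ↦ x) (haem g) (by fun_prop), hΦ, integral_id_gaussianReal]
  refine ⟨Ω, inferInstance, P, inferInstance, fun t ↦ Φ (f t), ⟨fun I ↦ ⟨?_⟩⟩, fun t ↦ hmean _,
    fun s t ↦ ?_⟩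
  · refine isGaussian_of_map_eq_gaussianReal fun L ↦
      ⟨0, ‖∑ i : I, L (Pi.single i 1) • f i‖₊ ^ 2, ?_⟩
    have h0 : AEMeasurable (fun ω ↦ I.restrict (fun t ↦ Φ (f t) ω)) P :=
      aemeasurable_pi_lambda _ fun i ↦ haem _
    rw [AEMeasurable.map_map_of_aemeasurable (by fun_prop) h0, ← hΦ]
    refine Measure.map_congr ?_
    have h2 : ∀ᵐ ω ∂P, ∀ i : I, (L (Pi.single i 1) • Φ (f i) : Lp ℝ 2 P) ω
        = L (Pi.single i 1) * Φ (f i) ω := by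
      refine ae_all_iff.2 fun i ↦ ?_
      filter_upwards [Lp.coeFn_smul (L (Pi.single i 1)) (Φ (f i))] with x h3
      simp [h3]
    rw [map_sum]
    simp_rw [map_smul]
    filter_upwards [Lp.coeFn_finsetSum Finset.univ fun i : I ↦ L (Pi.single i 1) • Φ (f i), h2]
      with ω h3 h4
    rw [h3, Finset.sum_apply, Finset.sum_congr rfl fun i _ ↦ h4 i, Function.comp_apply]
    have h5 (v : I → ℝ) : L v = ∑ i, L (Pi.single i 1) * v i := by
      conv_lhs => rw [← Finset.univ_sum_single v, map_sum]
      refine Finset.sum_congr rfl fun i _ ↦ ?_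
      rw [mul_comm, ← smul_eq_mul, ← map_smul, ← Pi.single_smul, smul_eq_mul, mul_one]
    exact h5 _
  · rw [covariance_eq_sub (Lp.memLp _) (Lp.memLp _), hmean, hmean, ← hf, ← Φ.inner_map_map,
      L2.inner_def]
    simp [mul_comm]

/-- Weak convergence, as `N → ∞`, of all finite-dimensional distributions of the processes
`Y 0, Y 1, …` (defined on `(Ω, P)`) to those of the process `X` (defined on `(Ω', P')`). -/
def TendstoFDD {Ω Ω' : Type*} [MeasurableSpace Ω] [MeasurableSpace Ω']
    (Y : ℕ → ℝ → Ω → ℝ) (P : Measure Ω) [IsProbabilityMeasure P]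
    (X : ℝ → Ω' → ℝ) (P' : Measure Ω') [IsProbabilityMeasure P'] : Prop :=
  ∀ (d : ℕ) (t : Fin d → ℝ), TendstoInDistribution (fun N ω k ↦ Y N (t k) ω) atTop
    (fun ω k ↦ X (t k) ω) (fun _ ↦ P) P'

/-! By Lévy's continuity theorem it suffices to treat characteristic functions of linear
combinations. For these the normalized sum has `N` i.i.d. summands, so the characteristic function
is an `N`-th power. Fix a time `S = s N + t₀` before all the times involved. Each summand factors as
`W D` with `W = exp(ξ(S)) / √(N exp(ψ(2) S))`, where `D` depends only on increments after `S`: it is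
independent of `W` and its law does not change with `N`.

Conditioning on `W`, the quantity `N (φ - 1 - i m)`, with `φ` and `m` the characteristic function at
1 and the mean of `W D`, equals `E[N W² q(log W)]`. Here `q` is the second-order Taylor quotient of
the characteristic function of `D`, which tends to `-E[D²]/2` at `-∞` and to `0` at `+∞`. The weight
`N W²` is exactly the density of the exponential tilting of `P` with parameter 2. Under it `ξ(S)` is
asymptotically normal with mean `ψ'(2) S` and variance `ψ''(2) S` (`tendsto_tilted_le`), and
critical growth says precisely that `log W ≤ y` has limiting probability `Φ(θ)` for every fixed `y`.
Hence mass `Φ(θ)` escapes to `-∞`, the rest to `+∞`, and the limit is `-Φ(θ) E[D²]/2`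
(`tendsto_integral_of_escape`, `tendsto_charFun_row`). Summands escaping to `+∞` are too large and
too rare to contribute.

Centering is harmless because `N m² → 0`, a consequence of `2ψ(1) < ψ(2)` (`tendsto_centered_pow`).
The mixed moments in `E[D²]` produce the Ornstein–Uhlenbeck covariance, and Slutsky's lemma
exchanges the normalizer for the true standard deviation. -/

/-! ### Exponential moments of a Lévy process. -/

/-- An additive function on `[0, ∞)` that is bounded below near `0` is linear. -/
theorem eq_mul_of_additive_of_bddBelow {g : ℝ≥0 → ℝ} (hadd : ∀ s t, g (s + t) = g s + g t)
    {C : ℝ} (hC : ∀ᶠ s in 𝓝 0, C ≤ g s) (s : ℝ≥0) : g s = g 1 * s := by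
  set f : ℝ≥0 → ℝ := fun s ↦ g s - g 1 * s with hf
  have fadd (s t) : f (s + t) = f s + f t := by
    simp only [hf, hadd, NNReal.coe_add]; ring
  have f0 : f 0 = 0 := by simpa using fadd 0 0
  have fmul (n : ℕ) (s) : f (n * s) = n * f s := by
    induction n with
    | zero => simp [f0]
    | succ n ih => push_cast; rw [add_mul, add_mul, fadd, ih]; simp
  have f1 : f 1 = 0 := by simp [hf]
  obtain ⟨ε, hε, hεC⟩ : ∃ ε > 0, ∀ s < ε, C ≤ g s := by
    simpa [NNReal.bot_eq_zero] using
      (nhds_bot_basis (α := ℝ≥0)).eventually_iff.1 (by simpa using hC)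
  obtain ⟨k, hk⟩ := exists_nat_gt (ε⁻¹)
  have hk0 : (0 : ℝ≥0) < k := (inv_pos.2 hε).trans hk
  have hkε : (k : ℝ≥0)⁻¹ < ε := inv_lt_of_inv_lt₀ hε hk
  -- This makes `1/k` a period of `f`, so every value of `f` is already taken on `[0, ε)`, where `g`
  -- is bounded below.
  have hfk : f (k : ℝ≥0)⁻¹ = 0 := by
    have := fmul k (k : ℝ≥0)⁻¹
    rw [mul_inv_cancel₀ hk0.ne', f1] at this
    have hk' : (k : ℝ) ≠ 0 := by exact_mod_cast hk0.ne'
    simpa [hk'] using this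
  have hbd (s) : C - |g 1| * ε ≤ f s := by
    set j := ⌊s * k⌋₊
    have hj : (j : ℝ≥0) ≤ s * k := Nat.floor_le (zero_le)
    have hj' : s * k < j + 1 := Nat.lt_floor_add_one _
    have hle : (j : ℝ≥0) * (k : ℝ≥0)⁻¹ ≤ s := by
      rw [← div_eq_mul_inv]; exact div_le_of_le_mul₀ hk0.le zero_le hj
    have hlt : s - j * (k : ℝ≥0)⁻¹ < ε := by
      refine lt_of_le_of_lt ?_ hkε
      rw [tsub_le_iff_right, ← one_add_mul, ← div_eq_mul_inv, le_div_iff₀ hk0, add_comm]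
      exact hj'.le
    have hs : f s = f (s - j * (k : ℝ≥0)⁻¹) := by
      conv_lhs => rw [← tsub_add_cancel_of_le hle]
      rw [fadd, fmul, hfk, mul_zero, add_zero]
    rw [hs]
    have h1 := hεC _ hlt
    have h2 : g 1 * ((s - j * (k : ℝ≥0)⁻¹ : ℝ≥0) : ℝ) ≤ |g 1| * ε :=
      (le_abs_self _).trans (by
        rw [abs_mul, NNReal.abs_eq]
        exact mul_le_mul_of_nonneg_left (by exact_mod_cast hlt.le) (abs_nonneg _))
    simp only [hf]
    linarith
  have hnn (s) : 0 ≤ f s := by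
    by_contra! h
    obtain ⟨n, hn⟩ := exists_nat_gt ((C - |g 1| * ε) / f s)
    have := hbd (n * s)
    rw [fmul] at this
    rw [div_lt_iff_of_neg h] at hn
    linarith
  -- `f s` and `f (n - s)` are nonnegative and add up to `f n = 0`.
  obtain ⟨n, hn⟩ := exists_nat_ge s
  have h1 : f s + f (n - s) = 0 := by
    rw [← fadd, add_tsub_cancel_of_le hn, ← mul_one (n : ℝ≥0), fmul, f1, mul_zero]
  have h2 : f s = 0 := le_antisymm (by linarith [hnn (n - s)]) (hnn s)
  simp only [hf] at h2
  linarith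

namespace IsLevyProcess

variable {Ω : Type*} [MeasurableSpace Ω] {ξ : ℝ≥0 → Ω → ℝ} {P : Measure Ω}

theorem indepFun_sub (hξ : IsLevyProcess ξ P) (s t : ℝ≥0) :
    IndepFun (ξ s) (ξ (s + t) - ξ s) P :=
  hξ.indep.indepFun_eval_sub zero_le le_self_add hξ.zero

theorem complexMGF_add (hξ : IsLevyProcess ξ P) (s t : ℝ≥0) (z : ℂ) :
    complexMGF (ξ (s + t)) P z = complexMGF (ξ s) P z * complexMGF (ξ t) P z := by
  rw [← complexMGF_congr_identDistrib (hξ.stationary s t)]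
  have h := (hξ.indepFun_sub s t).integral_fun_comp_mul_comp
    (f := fun x : ℝ ↦ Complex.exp (z * x)) (g := fun x : ℝ ↦ Complex.exp (z * x))
    (hξ.measurable s).aemeasurable ((hξ.measurable _).sub (hξ.measurable s)).aemeasurable
    (by fun_prop) (by fun_prop)
  simp only [complexMGF]
  refine Eq.trans ?_ h
  refine integral_congr_ae (ae_of_all _ fun ω ↦ ?_)
  simp only [Pi.sub_apply]
  rw [← Complex.exp_add]
  congr 1
  push_cast
  ring

theorem mgf_add (hξ : IsLevyProcess ξ P) (s t : ℝ≥0) (u : ℝ) :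
    mgf (ξ (s + t)) P u = mgf (ξ s) P u * mgf (ξ t) P u := by
  have := hξ.complexMGF_add s t u
  simp only [complexMGF_ofReal] at this
  exact_mod_cast this

variable [IsProbabilityMeasure P]

theorem mgf_zero_time (hξ : IsLevyProcess ξ P) (u : ℝ) : mgf (ξ 0) P u = 1 := by
  rw [mgf_congr hξ.zero]; simp

/-- The integral of a non-integrable function is 0 by default, so positivity of `mgf` encodes
integrability. It holds at integer times by taking powers, and `mgf (ξ s)` is a factor of `mgf (ξ
n)` for `s ≤ n`. -/
theorem mgf_pos (hξ : IsLevyProcess ξ P)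
    (hfin : ∀ u : ℝ, Integrable (fun ω ↦ Real.exp (u * ξ 1 ω)) P) (s : ℝ≥0) (u : ℝ) :
    0 < mgf (ξ s) P u := by
  have hn (n : ℕ) : 0 < mgf (ξ n) P u := by
    induction n with
    | zero => simp [hξ.mgf_zero_time]
    | succ n ih => push_cast; rw [hξ.mgf_add]; exact mul_pos ih (mgf_pos_iff.2 (hfin u))
  obtain ⟨n, hn'⟩ := exists_nat_ge s
  have h := hn n
  rw [← add_tsub_cancel_of_le hn', hξ.mgf_add] at h
  exact mgf_nonneg.lt_of_ne' (left_ne_zero_of_mul h.ne')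

theorem integrable_exp (hξ : IsLevyProcess ξ P)
    (hfin : ∀ u : ℝ, Integrable (fun ω ↦ Real.exp (u * ξ 1 ω)) P) (s : ℝ≥0) (u : ℝ) :
    Integrable (fun ω ↦ Real.exp (u * ξ s ω)) P :=
  mgf_pos_iff.1 (hξ.mgf_pos hfin s u)

theorem integrableExpSet_eq (hξ : IsLevyProcess ξ P)
    (hfin : ∀ u : ℝ, Integrable (fun ω ↦ Real.exp (u * ξ 1 ω)) P) (s : ℝ≥0) :
    integrableExpSet (ξ s) P = Set.univ :=
  Set.eq_univ_of_forall (hξ.integrable_exp hfin s)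

/-- Right-continuity at 0 and Fatou's lemma bound the liminf below by 1. This one-sided bound
suffices for the linearity of `log mgf` in time, so no domination is needed. -/
theorem eventually_lt_mgf (hξ : IsLevyProcess ξ P)
    (hfin : ∀ u : ℝ, Integrable (fun ω ↦ Real.exp (u * ξ 1 ω)) P) (u : ℝ) :
    ∀ᶠ s in 𝓝 0, 1 / 2 < mgf (ξ s) P u := by
  have h1 : (1 : ENNReal) ≤
      liminf (fun s : ℝ≥0 ↦ ∫⁻ ω, ENNReal.ofReal (Real.exp (u * ξ s ω)) ∂P) (𝓝 0) := by
    refine le_trans ?_ (lintegral_liminf_le fun s ↦ ?_)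
    · have : ∀ᵐ ω ∂P, (1 : ENNReal) =
          liminf (fun s : ℝ≥0 ↦ ENNReal.ofReal (Real.exp (u * ξ s ω))) (𝓝 0) := by
        filter_upwards [hξ.cadlag, hξ.zero] with ω hω h0
        have hc : Tendsto (fun s ↦ ξ s ω) (𝓝 0) (𝓝 0) := by
          have := (hω 0).1
          have huniv : Set.Ici (0 : ℝ≥0) = Set.univ :=
            Set.eq_univ_of_forall fun _ ↦ Set.mem_Ici.2 zero_le
          rw [huniv, continuousWithinAt_univ] at this
          simpa [ContinuousAt, h0] using this
        have := ENNReal.tendsto_ofReal ((Real.continuous_exp.tendsto _).comp (hc.const_mul u))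
        simp only [mul_zero, Real.exp_zero, ENNReal.ofReal_one] at this
        exact this.liminf_eq.symm
      rw [← lintegral_congr_ae this]
      simp
    · exact ((hξ.measurable s).const_mul u).exp.ennreal_ofReal
  have h2 := eventually_lt_of_lt_liminf (lt_of_lt_of_le
    (show ENNReal.ofReal (1 / 2) < 1 by rw [ENNReal.ofReal_lt_one]; norm_num) h1)
  filter_upwards [h2] with s hs
  rw [← ofReal_integral_eq_lintegral_ofReal (hξ.integrable_exp hfin s u)
    (ae_of_all _ fun _ ↦ (Real.exp_pos _).le)] at hs
  exact (ENNReal.ofReal_lt_ofReal_iff_of_nonneg (by norm_num)).1 hs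

/-- The moment generating function of a Lévy process at time `s` is `exp(ψ(u) s)`. -/
theorem mgf_eq (hξ : IsLevyProcess ξ P)
    (hfin : ∀ u : ℝ, Integrable (fun ω ↦ Real.exp (u * ξ 1 ω)) P) (s : ℝ≥0) (u : ℝ) :
    mgf (ξ s) P u = Real.exp (psi ξ P u * s) := by
  have h := eq_mul_of_additive_of_bddBelow (g := fun s ↦ Real.log (mgf (ξ s) P u))
    (C := Real.log (1 / 2))
    (fun s t ↦ by
      rw [hξ.mgf_add, Real.log_mul (hξ.mgf_pos hfin _ _).ne' (hξ.mgf_pos hfin _ _).ne'])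
    (by
      filter_upwards [hξ.eventually_lt_mgf hfin u] with s hs
      exact Real.log_le_log (by norm_num) hs.le) s
  have h1 : psi ξ P u = Real.log (mgf (ξ 1) P u) := rfl
  rw [h1, ← h, Real.exp_log (hξ.mgf_pos hfin _ _)]

end IsLevyProcess

/-! ### Joint law of the increments after a given time. -/

/-- Independence of increments concerns ordered times; sorting reduces arbitrary finite families of
times to that case. -/
theorem exists_monotone_grid {ι α : Type*} [Finite ι] [LinearOrder α] [Inhabited α] (h : ι → α) :
    ∃ (u : ℕ → α) (σ : ι → ℕ), Monotone u ∧ ∀ k, u (σ k) = h k := by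
  classical
  have := Fintype.ofFinite ι
  set A := Finset.univ.image h with hA
  rcases isEmpty_or_nonempty ι with hι | hι
  · exact ⟨fun _ ↦ default, fun _ ↦ 0, monotone_const, fun k ↦ isEmptyElim k⟩
  have hne : A.Nonempty := Finset.univ_nonempty.image h
  have hpos : 0 < A.card := hne.card_pos
  let e := A.orderIsoOfFin rfl
  -- `e` lists the distinct values in order; the cap keeps `u` constant after the last one.
  refine ⟨fun i ↦ e ⟨min i (A.card - 1), by omega⟩,
    fun k ↦ (e.symm ⟨h k, Finset.mem_image_of_mem h (Finset.mem_univ k)⟩ : Fin A.card), ?_, ?_⟩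
  · intro i j hij
    have : (⟨min i (A.card - 1), by omega⟩ : Fin A.card) ≤ ⟨min j (A.card - 1), by omega⟩ := by
      rw [Fin.mk_le_mk]; omega
    exact e.monotone this
  · intro k
    have : ∀ x : Fin A.card, (⟨min (x : ℕ) (A.card - 1), by omega⟩ : Fin A.card) = x := by
      intro x
      ext
      simp only
      omega
    simp only [this, OrderIso.apply_symm_apply]

/-- The time grid `0, S, S + u 0, S + u 1, …`. -/
def shiftedGrid (S : ℝ≥0) (u : ℕ → ℝ≥0) : ℕ → ℝ≥0
  | 0 => 0
  | 1 => S
  | i + 2 => S + u i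

namespace IsLevyProcess

variable {Ω : Type*} [MeasurableSpace Ω] {ξ : ℝ≥0 → Ω → ℝ} {P : Measure Ω}

theorem iIndepFun_shifted_increments (hξ : IsLevyProcess ξ P) {u : ℕ → ℝ≥0} (hu : Monotone u)
    (S : ℝ≥0) :
    iIndepFun (fun i ω ↦ ξ (shiftedGrid S u (i + 1)) ω - ξ (shiftedGrid S u i) ω) P := by
  refine hξ.indep.nat (monotone_nat_of_le_succ fun n ↦ ?_)
  rcases n with _ | _ | n
  · exact zero_le
  · exact le_self_add
  · exact add_le_add_right (hu (Nat.le_succ n)) S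

omit [MeasurableSpace Ω] in
theorem sum_shifted_increments (ξ : ℝ≥0 → Ω → ℝ) (u : ℕ → ℝ≥0) (S : ℝ≥0) (j : ℕ) (ω : Ω) :
    ∑ i ∈ Finset.range (j + 1),
      (ξ (shiftedGrid S u (i + 2)) ω - ξ (shiftedGrid S u (i + 1)) ω) =
        ξ (S + u j) ω - ξ S ω := by
  rw [Finset.sum_range_sub (fun i ↦ ξ (shiftedGrid S u (i + 1)) ω)]
  rfl

theorem identDistrib_of_le (hξ : IsLevyProcess ξ P) {s t : ℝ≥0} (h : s ≤ t) :
    IdentDistrib (fun ω ↦ ξ t ω - ξ s ω) (ξ (t - s)) P P := by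
  have := hξ.stationary s (t - s)
  rwa [add_tsub_cancel_of_le h] at this

/-- The increments of a Lévy process after time `S` are independent of its value at time `S`. -/
theorem indepFun_increments (hξ : IsLevyProcess ξ P) {ι : Type*} [Fintype ι] (h : ι → ℝ≥0)
    (S : ℝ≥0) : IndepFun (ξ S) (fun ω k ↦ ξ (S + h k) ω - ξ S ω) P := by
  classical
  obtain ⟨u, σ, hu, hσ⟩ := exists_monotone_grid h
  obtain ⟨M, hM⟩ : ∃ M, ∀ k, σ k < M :=
    ⟨Finset.univ.sup σ + 1, fun k ↦ Nat.lt_succ_of_le (Finset.le_sup (Finset.mem_univ k))⟩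
  have hind := hξ.iIndepFun_shifted_increments hu S
  have h1 := hind.indepFun_finset {0} (Finset.Icc 1 M) (by simp)
    fun i ↦ (hξ.measurable _).sub (hξ.measurable _)
  have hφ : Measurable fun y : ({0} : Finset ℕ) → ℝ ↦ y ⟨0, by simp⟩ := measurable_pi_apply _
  -- Index 0 is the increment over `[0, S]`, so those after `S` start at index 1. The branch `else
  -- 0` never occurs because `σ k < M`.
  have hψ : Measurable fun (y : Finset.Icc 1 M → ℝ) (k : ι) ↦
      ∑ i ∈ Finset.range (σ k + 1), if hi : i + 1 ∈ Finset.Icc 1 M then y ⟨i + 1, hi⟩ else 0 := by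
    refine measurable_pi_lambda _ fun k ↦ Finset.measurable_fun_sum _ fun i _ ↦ ?_
    split_ifs
    · exact measurable_pi_apply _
    · fun_prop
  have h2 := h1.comp hφ hψ
  refine h2.congr ?_ (ae_of_all _ fun ω ↦ ?_)
  · filter_upwards [hξ.zero] with ω hω
    simp [shiftedGrid, hω]
  · ext k
    simp only [Function.comp_apply]
    rw [← hσ k, ← sum_shifted_increments ξ u S (σ k) ω]
    refine Finset.sum_congr rfl fun i hi ↦ ?_
    rw [dif_pos]
    have := hM k
    simp only [Finset.mem_range] at hi
    simp only [Finset.mem_Icc]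
    omega

/-- The increments of a Lévy process are jointly stationary. -/
theorem identDistrib_increments (hξ : IsLevyProcess ξ P) {ι : Type*} [Fintype ι] (h : ι → ℝ≥0)
    (S : ℝ≥0) : IdentDistrib (fun ω k ↦ ξ (S + h k) ω - ξ S ω) (fun ω k ↦ ξ (h k) ω) P P := by
  obtain ⟨u, σ, hu, hσ⟩ := exists_monotone_grid h
  -- Dropping the increment over `[0, S]` leaves increments whose lengths do not depend on `S`.
  have key (S : ℝ≥0) := (hξ.iIndepFun_shifted_increments hu S).precomp (Nat.succ_injective)
  have h1 := IdentDistrib.pi (fun i ↦ ?_) (key S) (key 0)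
  · have hC : Measurable fun (y : ℕ → ℝ) (k : ι) ↦ ∑ i ∈ Finset.range (σ k + 1), y i := by
      fun_prop
    have h2 := h1.comp hC
    have h3 (S : ℝ≥0) := funext fun ω ↦ funext fun k ↦ sum_shifted_increments ξ u S (σ k) ω
    simp only [hσ] at h3
    have h4 : (fun ω k ↦ ξ (0 + h k) ω - ξ 0 ω) =ᵐ[P] fun ω k ↦ ξ (h k) ω := by
      filter_upwards [hξ.zero] with ω hω
      simp [hω]
    have h5 : IdentDistrib (fun ω k ↦ ξ (S + h k) ω - ξ S ω)
        (fun ω k ↦ ξ (0 + h k) ω - ξ 0 ω) P P := by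
      rw [← h3, ← h3]
      exact h2
    exact h5.trans (IdentDistrib.of_ae_eq h5.aemeasurable_snd h4)
  · rcases i with _ | i
    · exact (hξ.identDistrib_of_le le_self_add).trans (by
        have := (hξ.identDistrib_of_le (le_self_add : (0 : ℝ≥0) ≤ 0 + u 0)).symm
        simpa [shiftedGrid] using this)
    · have hle : u i ≤ u (i + 1) := hu (Nat.le_succ i)
      have a (S : ℝ≥0) := hξ.identDistrib_of_le (add_le_add_right hle S)
      simp only [add_tsub_add_eq_tsub_left] at a
      exact (a S).trans (a 0).symm

/-! ### Convexity of `ψ` and moments under exponential tilting. -/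

variable [IsProbabilityMeasure P]

/-- The inequality is strict positivity of the variance of `exp (ξ 1)`. -/
theorem two_mul_psi_one_lt (hξ : IsLevyProcess ξ P)
    (hfin : ∀ u : ℝ, Integrable (fun ω ↦ Real.exp (u * ξ 1 ω)) P)
    (hconst : ¬ ∃ a : ℝ, ∀ᵐ ω ∂P, ξ 1 ω = a) : 2 * psi ξ P 1 < psi ξ P 2 := by
  have hm : MemLp (fun ω ↦ Real.exp (ξ 1 ω)) 2 P := by
    rw [memLp_two_iff_integrable_sq (hξ.measurable 1).exp.aestronglyMeasurable]
    refine (hfin 2).congr (ae_of_all _ fun ω ↦ ?_)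
    simp only [← Real.exp_nat_mul]; norm_num
  have hv : 0 < Var[fun ω ↦ Real.exp (ξ 1 ω); P] := by
    refine (variance_nonneg _ _).lt_of_ne' fun h0 ↦ hconst ?_
    rw [variance, ENNReal.toReal_eq_zero_iff, or_iff_left hm.evariance_ne_top,
      evariance_eq_zero_iff hm.aestronglyMeasurable.aemeasurable] at h0
    refine ⟨Real.log (∫ ω, Real.exp (ξ 1 ω) ∂P), ?_⟩
    filter_upwards [h0] with ω hω
    rw [← hω, Real.log_exp]
  rw [variance_eq_sub hm] at hv
  have e1 : ∫ ω, ((fun ω ↦ Real.exp (ξ 1 ω)) ^ 2) ω ∂P = mgf (ξ 1) P 2 := by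
    refine integral_congr_ae (ae_of_all _ fun ω ↦ ?_)
    simp only [Pi.pow_apply, ← Real.exp_nat_mul]; norm_num
  have e2 : ∫ ω, Real.exp (ξ 1 ω) ∂P = mgf (ξ 1) P 1 := by simp [mgf]
  rw [e1, e2, hξ.mgf_eq hfin, hξ.mgf_eq hfin, ← Real.exp_nat_mul, sub_pos, Real.exp_lt_exp] at hv
  simpa using hv

theorem integral_tilted (hξ : IsLevyProcess ξ P)
    (hfin : ∀ u : ℝ, Integrable (fun ω ↦ Real.exp (u * ξ 1 ω)) P) (u : ℝ) :
    ∫ ω, ξ 1 ω ∂(P.tilted (u * ξ 1 ·)) = deriv (psi ξ P) u :=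
  integral_tilted_mul_self (by simp [hξ.integrableExpSet_eq hfin])

theorem memLp_tilted (hξ : IsLevyProcess ξ P)
    (hfin : ∀ u : ℝ, Integrable (fun ω ↦ Real.exp (u * ξ 1 ω)) P) (u : ℝ) :
    MemLp (ξ 1) 2 (P.tilted (u * ξ 1 ·)) :=
  memLp_tilted_mul (by simp [hξ.integrableExpSet_eq hfin]) 2

theorem variance_tilted (hξ : IsLevyProcess ξ P)
    (hfin : ∀ u : ℝ, Integrable (fun ω ↦ Real.exp (u * ξ 1 ω)) P) (u : ℝ) :
    Var[ξ 1; P.tilted (u * ξ 1 ·)] = iteratedDeriv 2 (psi ξ P) u :=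
  variance_tilted_mul (by simp [hξ.integrableExpSet_eq hfin])

theorem iteratedDeriv_two_psi_pos (hξ : IsLevyProcess ξ P)
    (hfin : ∀ u : ℝ, Integrable (fun ω ↦ Real.exp (u * ξ 1 ω)) P)
    (hconst : ¬ ∃ a : ℝ, ∀ᵐ ω ∂P, ξ 1 ω = a) (u : ℝ) : 0 < iteratedDeriv 2 (psi ξ P) u := by
  have := isProbabilityMeasure_tilted (hfin u)
  have hm := hξ.memLp_tilted hfin u
  rw [← hξ.variance_tilted hfin]
  refine (variance_nonneg _ _).lt_of_ne' fun h0 ↦ hconst ?_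
  rw [variance, ENNReal.toReal_eq_zero_iff, or_iff_left hm.evariance_ne_top,
    evariance_eq_zero_iff hm.aestronglyMeasurable.aemeasurable] at h0
  -- The tilting density is positive, so almost sure constancy transfers back to `P`.
  exact ⟨_, (absolutelyContinuous_tilted (hfin u)).ae_le h0⟩

end IsLevyProcess

/-! ### Central limit theorem under exponential tilting. -/

/-- Follows from `log (1 + g) - g = O(g²)`. The exponents are arbitrary integers, later `⌊S N⌋₊`, so
`g → 0` is assumed separately. -/
theorem tendsto_one_add_pow_exp_of_tendsto_mul {ι : Type*} {l : Filter ι} {m : ι → ℕ} {g : ι → ℂ}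
    {t : ℂ} (hg : Tendsto g l (𝓝 0)) (hmg : Tendsto (fun i ↦ m i * g i) l (𝓝 t)) :
    Tendsto (fun i ↦ (1 + g i) ^ m i) l (𝓝 (Complex.exp t)) := by
  have h1 : Tendsto (fun i ↦ (m i : ℂ) * Complex.log (1 + g i)) l (𝓝 t) := by
    have h2 : (fun i ↦ (m i : ℂ) * (Complex.log (1 + g i) - g i)) =O[l]
        fun i ↦ (m i * g i) * g i := by
      have := (isBigO_refl (fun i ↦ (m i : ℂ)) l).mul (Complex.log_sub_self_isBigO.comp_tendsto hg)
      refine this.congr_right fun i ↦ ?_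
      simp only [Function.comp_apply]; ring
    have h3 := h2.trans_tendsto (by simpa using hmg.mul hg)
    have := h3.add hmg
    simp only [zero_add] at this
    refine this.congr fun i ↦ ?_
    ring
  refine ((Complex.continuous_exp.tendsto t).comp h1).congr' ?_
  have : ∀ᶠ i in l, 1 + g i ≠ 0 := by
    have h : Tendsto (fun i ↦ 1 + g i) l (𝓝 1) := by simpa using hg.const_add 1
    exact h.eventually_ne one_ne_zero
  filter_upwards [this] with i hi
  simp only [Function.comp_apply]
  rw [Complex.exp_nat_mul, Complex.exp_log hi]

namespace IsLevyProcess

variable {Ω : Type*} [MeasurableSpace Ω] {ξ : ℝ≥0 → Ω → ℝ} {P : Measure Ω}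

theorem charFun_tilted (hξ : IsLevyProcess ξ P) (s : ℝ≥0) (u v : ℝ) :
    charFun ((P.tilted (u * ξ s ·)).map (ξ s)) v =
      complexMGF (ξ s) P (u + v * Complex.I) / mgf (ξ s) P u := by
  rw [charFun_apply_real, integral_map (hξ.measurable s).aemeasurable (by fun_prop),
    integral_tilted_mul_eq_mgf, complexMGF, ← integral_div]
  refine integral_congr_ae (ae_of_all _ fun ω ↦ ?_)
  simp only [Complex.real_smul]
  push_cast
  rw [div_mul_eq_mul_div, ← Complex.exp_add]
  congr 2
  ring

theorem charFun_tilted_add (hξ : IsLevyProcess ξ P) (s t : ℝ≥0) (u v : ℝ) :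
    charFun ((P.tilted (u * ξ (s + t) ·)).map (ξ (s + t))) v =
      charFun ((P.tilted (u * ξ s ·)).map (ξ s)) v *
        charFun ((P.tilted (u * ξ t ·)).map (ξ t)) v := by
  simp only [hξ.charFun_tilted, hξ.complexMGF_add, hξ.mgf_add]
  push_cast
  rw [mul_div_mul_comm]

variable [IsProbabilityMeasure P]

theorem charFun_tilted_nat (hξ : IsLevyProcess ξ P) (n : ℕ) (u v : ℝ) :
    charFun ((P.tilted (u * ξ n ·)).map (ξ n)) v =
      charFun ((P.tilted (u * ξ 1 ·)).map (ξ 1)) v ^ n := by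
  induction n with
  | zero =>
    rw [Nat.cast_zero, hξ.charFun_tilted, hξ.mgf_zero_time, complexMGF]
    have : ∀ᵐ ω ∂P, Complex.exp ((u + v * Complex.I) * ξ 0 ω) = 1 := by
      filter_upwards [hξ.zero] with ω hω
      simp [hω]
    rw [integral_congr_ae this]
    simp
  | succ n ih => rw [Nat.cast_succ, hξ.charFun_tilted_add, ih, pow_succ]

theorem isProbabilityMeasure_tilted (hξ : IsLevyProcess ξ P)
    (hfin : ∀ u : ℝ, Integrable (fun ω ↦ Real.exp (u * ξ 1 ω)) P) (s : ℝ≥0) (u : ℝ) :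
    IsProbabilityMeasure (P.tilted (u * ξ s ·)) :=
  MeasureTheory.isProbabilityMeasure_tilted (hξ.integrable_exp hfin s u)

/-- Controls the fractional part of the time uniformly: `|exp(ivx) - 1| ≤ |v| |x| ≤ |v| (exp x + exp
(-x))`, and the tilted moments of `exp (±ξ s)` are `exp ((ψ(u ± 1) - ψ(u)) s)`. -/
theorem exists_norm_charFun_tilted_sub_one_le (hξ : IsLevyProcess ξ P)
    (hfin : ∀ u : ℝ, Integrable (fun ω ↦ Real.exp (u * ξ 1 ω)) P) (u : ℝ) :
    ∃ K : ℝ, ∀ s ≤ 1, ∀ v, ‖charFun ((P.tilted (u * ξ s ·)).map (ξ s)) v - 1‖ ≤ K * |v| := by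
  set ψ := psi ξ P
  refine ⟨Real.exp |ψ (u + 1) - ψ u| + Real.exp |ψ (u - 1) - ψ u|, fun s hs v ↦ ?_⟩
  have := hξ.isProbabilityMeasure_tilted hfin s u
  have hexp : ∀ w, Real.exp (w * s) ≤ Real.exp |w| := fun w ↦ by
    rw [Real.exp_le_exp]
    calc w * s ≤ |w| * s := mul_le_mul_of_nonneg_right (le_abs_self w) s.2
      _ ≤ |w| * 1 := mul_le_mul_of_nonneg_left (by exact_mod_cast hs) (abs_nonneg w)
      _ = |w| := mul_one _
  have hI (w : ℝ) : ∫ ω, Real.exp (w * ξ s ω) ∂(P.tilted (u * ξ s ·)) =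
      Real.exp ((ψ (u + w) - ψ u) * s) := by
    rw [integral_tilted_mul_eq_mgf]
    have : ∀ ω, (Real.exp (u * ξ s ω) / mgf (ξ s) P u) • Real.exp (w * ξ s ω) =
        Real.exp ((u + w) * ξ s ω) / mgf (ξ s) P u := fun ω ↦ by
      rw [smul_eq_mul, div_mul_eq_mul_div, ← Real.exp_add]; ring_nf
    simp only [this]
    rw [MeasureTheory.integral_div]
    change mgf (ξ s) P (u + w) / _ = _
    rw [hξ.mgf_eq hfin, hξ.mgf_eq hfin, ← Real.exp_sub, sub_mul]
  have hint (w : ℝ) : Integrable (fun ω ↦ Real.exp (w * ξ s ω)) (P.tilted (u * ξ s ·)) := by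
    rw [integrable_tilted_iff (hξ.integrable_exp hfin s u)]
    refine (hξ.integrable_exp hfin s (u + w)).congr (ae_of_all _ fun ω ↦ ?_)
    simp only [smul_eq_mul]
    rw [← Real.exp_add]; ring_nf
  rw [charFun_apply_real, integral_map (hξ.measurable s).aemeasurable (by fun_prop)]
  have hb : Integrable (fun ω ↦ Complex.exp (v * ξ s ω * Complex.I)) (P.tilted (u * ξ s ·)) := by
    refine Integrable.of_bound (C := 1) ?_ (ae_of_all _ fun ω ↦ ?_)
    · have := hξ.measurable s
      exact (by fun_prop : Measurable _).aestronglyMeasurable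
    · rw [← Complex.ofReal_mul, Complex.norm_exp_ofReal_mul_I]
  have h1 : (1 : ℂ) = ∫ _, (1 : ℂ) ∂(P.tilted (u * ξ s ·)) := by simp
  rw [h1, ← integral_sub hb (integrable_const _)]
  calc _ ≤ ∫ ω, |v| * (Real.exp (1 * ξ s ω) + Real.exp (-1 * ξ s ω)) ∂(P.tilted (u * ξ s ·)) := by
        refine norm_integral_le_of_norm_le (((hint 1).add (hint (-1))).const_mul |v|)
          (ae_of_all _ fun ω ↦ ?_)
        have := Real.norm_exp_I_mul_ofReal_sub_one_le (x := v * ξ s ω)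
        rw [mul_comm, Complex.ofReal_mul] at this
        refine this.trans ?_
        rw [norm_mul, Real.norm_eq_abs, Real.norm_eq_abs]
        refine mul_le_mul_of_nonneg_left ?_ (abs_nonneg v)
        rw [one_mul, neg_one_mul]
        have h3 := Real.add_one_le_exp (ξ s ω)
        have h4 := Real.add_one_le_exp (-ξ s ω)
        exact abs_le.2 ⟨by linarith [Real.exp_pos (ξ s ω)], by linarith [Real.exp_pos (-ξ s ω)]⟩
    _ = |v| * (Real.exp ((ψ (u + 1) - ψ u) * s) + Real.exp ((ψ (u + -1) - ψ u) * s)) := by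
        rw [integral_const_mul, integral_add (hint 1) (hint (-1)), hI, hI]
    _ ≤ _ := by
        rw [mul_comm]
        exact mul_le_mul_of_nonneg_right (add_le_add (hexp _) (hexp _)) (abs_nonneg v)

/-- The characteristic function of the normalized increment over a time unit of the tilted
process. -/
theorem charFun_tilted_one_eq (hξ : IsLevyProcess ξ P)
    (hfin : ∀ u : ℝ, Integrable (fun ω ↦ Real.exp (u * ξ 1 ω)) P)
    (hconst : ¬ ∃ a : ℝ, ∀ᵐ ω ∂P, ξ 1 ω = a) (u : ℝ) :
    ∃ χ : ℝ → ℂ, (∀ v, charFun ((P.tilted (u * ξ 1 ·)).map (ξ 1)) v =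
        χ (√(iteratedDeriv 2 (psi ξ P) u) * v) * Complex.exp (v * deriv (psi ξ P) u * Complex.I)) ∧
      (fun v ↦ χ v - (1 - v ^ 2 / 2)) =o[𝓝 0] fun v : ℝ ↦ v ^ 2 := by
  have := hξ.isProbabilityMeasure_tilted hfin 1 u
  set Q := P.tilted (u * ξ 1 ·) with hQ
  set m := deriv (psi ξ P) u
  set σ := √(iteratedDeriv 2 (psi ξ P) u)
  have hσ2 := hξ.iteratedDeriv_two_psi_pos hfin hconst u
  have hσ : 0 < σ := Real.sqrt_pos.2 hσ2
  set Y : Ω → ℝ := fun ω ↦ (ξ 1 ω - m) / σ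
  have hmem := hξ.memLp_tilted hfin u
  have hYm : AEMeasurable Y Q := (((hξ.measurable 1).sub_const m).div_const σ).aemeasurable
  have hE := hξ.integral_tilted hfin u
  refine ⟨charFun (Q.map Y), fun v ↦ ?_, taylor_charFun_two hYm ?_ ?_⟩
  · rw [charFun_apply_real, charFun_apply_real,
      integral_map (hξ.measurable 1).aemeasurable (by fun_prop), integral_map hYm (by fun_prop),
      ← integral_mul_const]
    refine integral_congr_ae (ae_of_all _ fun ω ↦ ?_)
    simp only [Y]
    rw [← Complex.exp_add]
    congr 1
    have : (σ : ℂ) ≠ 0 := by exact_mod_cast hσ.ne'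
    push_cast
    field_simp
    ring
  · simp only [Y]
    rw [MeasureTheory.integral_div, integral_sub (hmem.integrable (by norm_num))
      (integrable_const _), hE]
    simp [m]
  · have hvar := hξ.variance_tilted hfin u
    rw [variance_eq_integral (hξ.measurable 1).aemeasurable, hE] at hvar
    simp only [Pi.pow_apply, Y, div_pow]
    rw [MeasureTheory.integral_div, hvar, Real.sq_sqrt hσ2.le, div_self hσ2.ne']

end IsLevyProcess

theorem tendsto_one_add_taylor_two_pow {χ : ℝ → ℂ}
    (hχ : (fun v ↦ χ v - (1 - v ^ 2 / 2)) =o[𝓝 0] fun v : ℝ ↦ v ^ 2) {S : ℕ → ℝ}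
    (hS : Tendsto S atTop atTop) (v : ℝ) :
    Tendsto (fun N ↦ χ (v / √(S N)) ^ ⌊S N⌋₊) atTop (𝓝 (Complex.exp (-v ^ 2 / 2))) := by
  have hs : Tendsto (fun N ↦ √(S N)) atTop atTop := Real.tendsto_sqrt_atTop.comp hS
  have hv : Tendsto (fun N ↦ v / √(S N)) atTop (𝓝 0) := hs.const_div_atTop v
  have hχ' : (fun v : ℝ ↦ χ v - (1 - v ^ 2 / 2)) =o[𝓝 0] fun v : ℝ ↦ ((v ^ 2 : ℝ) : ℂ) :=
    Complex.isLittleO_ofReal_right.2 hχ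
  have h1 := hχ'.tendsto_div_nhds_zero.comp hv
  have h2 := hv.eventually hχ'.eventually_mul_div_cancel
  have h3 : Tendsto (fun N ↦ ((⌊S N⌋₊ / S N : ℝ) : ℂ)) atTop (𝓝 1) := by
    exact (Complex.continuous_ofReal.tendsto 1).comp
      ((tendsto_nat_floor_div_atTop (R := ℝ)).comp hS)
  have h5 := h3.mul ((h1.sub_const (1 / 2)).const_mul ((v : ℂ) ^ 2))
  have h6 : Tendsto (fun N ↦ (⌊S N⌋₊ : ℂ) * (χ (v / √(S N)) - 1)) atTop (𝓝 (-v ^ 2 / 2)) := by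
    refine (h5.congr' ?_).trans (le_of_eq (by congr 1; ring))
    filter_upwards [h2, hS.eventually_gt_atTop 0] with N hN hN0
    simp only [Pi.mul_apply, Pi.div_apply, Function.comp_apply] at hN ⊢
    have h7 : (v / √(S N)) ^ 2 = v ^ 2 / S N := by rw [div_pow, Real.sq_sqrt hN0.le]
    have h8 : ((v / √(S N) : ℝ) : ℂ) ^ 2 = ((v ^ 2 / S N : ℝ) : ℂ) := by
      rw [← Complex.ofReal_pow, h7]
    simp only [h7, h8] at hN ⊢
    generalize (χ (v / √(S N)) - (1 - ((v ^ 2 / S N : ℝ) : ℂ) / 2)) / ((v ^ 2 / S N : ℝ) : ℂ) = E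
      at hN ⊢
    push_cast at hN ⊢
    linear_combination (⌊S N⌋₊ : ℂ) * hN
  have h9 : Tendsto (fun N ↦ χ (v / √(S N)) - 1) atTop (𝓝 0) := by
    have h10 := (h1.sub_const (1 / 2)).mul ((Complex.continuous_ofReal.tendsto _).comp (hv.pow 2))
    simp only [ne_eq, OfNat.ofNat_ne_zero, not_false_eq_true, zero_pow, Complex.ofReal_zero,
      mul_zero] at h10
    refine h10.congr' ?_
    filter_upwards [h2] with N hN
    simp only [Pi.mul_apply, Pi.div_apply, Function.comp_apply] at hN ⊢
    rw [sub_mul, hN]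
    push_cast
    ring
  have := tendsto_one_add_pow_exp_of_tendsto_mul h9 h6
  simpa using this

theorem gaussianReal_neg_one_Iic_zero (x : ℝ) :
    (gaussianReal (-x) 1).real (Set.Iic 0) = cdf (gaussianReal 0 1) x := by
  have h := gaussianReal_map_add_const (μ := 0) (v := 1) (-x)
  rw [zero_add] at h
  rw [cdf_eq_real, ← h, map_measureReal_apply (by fun_prop) measurableSet_Iic]
  congr 1
  ext y
  simp

namespace IsLevyProcess

variable {Ω : Type*} [MeasurableSpace Ω] {ξ : ℝ≥0 → Ω → ℝ} {P : Measure Ω}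
  [IsProbabilityMeasure P]

/-- The central limit theorem for the tilted Lévy process, at the level of characteristic
functions. -/
theorem tendsto_charFun_tilted_normalized (hξ : IsLevyProcess ξ P)
    (hfin : ∀ u : ℝ, Integrable (fun ω ↦ Real.exp (u * ξ 1 ω)) P)
    (hconst : ¬ ∃ a : ℝ, ∀ᵐ ω ∂P, ξ 1 ω = a) (u : ℝ) {S : ℕ → ℝ≥0} {y : ℕ → ℝ} {x : ℝ}
    (hS : Tendsto (fun N ↦ (S N : ℝ)) atTop atTop)
    (hy : Tendsto (fun N ↦ (y N - deriv (psi ξ P) u * S N) /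
      (√(iteratedDeriv 2 (psi ξ P) u) * √(S N))) atTop (𝓝 x)) (v : ℝ) :
    Tendsto (fun N ↦ charFun ((P.tilted (u * ξ (S N) ·)).map fun ω ↦
      (ξ (S N) ω - y N) / (√(iteratedDeriv 2 (psi ξ P) u) * √(S N))) v) atTop
      (𝓝 (charFun (gaussianReal (-x) 1) v)) := by
  obtain ⟨χ, hχ, hχ2⟩ := hξ.charFun_tilted_one_eq hfin hconst u
  obtain ⟨K, hK⟩ := hξ.exists_norm_charFun_tilted_sub_one_le hfin u
  set m := deriv (psi ξ P) u
  set σ := √(iteratedDeriv 2 (psi ξ P) u)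
  have hσ : 0 < σ := Real.sqrt_pos.2 (hξ.iteratedDeriv_two_psi_pos hfin hconst u)
  have hs : Tendsto (fun N ↦ σ * √(S N)) atTop atTop :=
    (Real.tendsto_sqrt_atTop.comp hS).const_mul_atTop hσ
  set w : ℕ → ℝ := fun N ↦ v / (σ * √(S N)) with hw
  have hw0 : Tendsto w atTop (𝓝 0) := hs.const_div_atTop v
  -- The integer part contributes a power of one fixed characteristic function. The remainder `r ≤
  -- 1` contributes a factor evaluated at `w → 0`, which tends to 1.
  set n : ℕ → ℕ := fun N ↦ ⌊(S N : ℝ)⌋₊ with hn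
  have hnS (N) : (n N : ℝ≥0) ≤ S N := by
    have := Nat.floor_le (S N).2
    exact_mod_cast this
  set r : ℕ → ℝ≥0 := fun N ↦ S N - n N with hr
  have hr1 (N) : r N ≤ 1 := by
    have := (Nat.lt_floor_add_one (S N : ℝ)).le
    rw [hr, tsub_le_iff_left]
    exact_mod_cast this
  have hSr (N) : (n N : ℝ≥0) + r N = S N := add_tsub_cancel_of_le (hnS N)
  have hSr' (N) : (n N : ℝ) + r N = S N := by exact_mod_cast congrArg NNReal.toReal (hSr N)
  have hcf (N) : charFun ((P.tilted (u * ξ (S N) ·)).map fun ω ↦ (ξ (S N) ω - y N) / (σ * √(S N))) v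
      = χ (σ * w N) ^ n N * charFun ((P.tilted (u * ξ (r N) ·)).map (ξ (r N))) (w N) *
        Complex.exp ((w N * m * n N - w N * y N) * Complex.I) := by
    have hfun : (fun ω ↦ (ξ (S N) ω - y N) / (σ * √(S N))) =
      (fun x ↦ (σ * √(S N))⁻¹ * (x + -y N)) ∘ ξ (S N) := by
      ext ω; simp only [Function.comp_apply]; ring
    rw [hfun, ← Measure.map_map (by fun_prop) (hξ.measurable _),
      show (fun x ↦ (σ * √(S N))⁻¹ * (x + -y N)) =
        (fun x ↦ (σ * √(S N))⁻¹ * x) ∘ (fun x ↦ x + -y N) from rfl,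
      ← Measure.map_map (by fun_prop) (by fun_prop), charFun_map_mul, charFun_map_add_const]
    have hwv : (σ * √(S N))⁻¹ * v = w N := by simp only [hw]; ring
    rw [hwv]
    conv_lhs => rw [← hSr N]
    rw [hξ.charFun_tilted_add, hξ.charFun_tilted_nat, hχ, mul_pow, ← Complex.exp_nat_mul]
    simp only [RCLike.inner_apply, conj_trivial]
    rw [mul_right_comm, mul_assoc _ (Complex.exp _) (Complex.exp _), ← Complex.exp_add,
      mul_right_comm]
    congr 2
    push_cast
    ring
  have hrem : Tendsto (fun N ↦ charFun ((P.tilted (u * ξ (r N) ·)).map (ξ (r N))) (w N)) atTop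
      (𝓝 1) := by
    rw [tendsto_iff_norm_sub_tendsto_zero]
    refine squeeze_zero (fun _ ↦ norm_nonneg _) (fun N ↦ hK _ (hr1 N) _) ?_
    simpa using hw0.abs.const_mul K
  have hmain : Tendsto (fun N ↦ χ (σ * w N) ^ n N) atTop (𝓝 (Complex.exp (-v ^ 2 / 2))) := by
    refine (tendsto_one_add_taylor_two_pow hχ2 hS v).congr fun N ↦ ?_
    congr 2
    simp only [hw]
    field_simp
  -- The phase is minus the sum of `v` times the quantity in `hy` and the error `w m r` from the
  -- fractional part.
  have hphase : Tendsto (fun N ↦ w N * m * n N - w N * y N) atTop (𝓝 (-(v * x))) := by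
    have h1 : Tendsto (fun N ↦ w N * m * r N) atTop (𝓝 0) := by
      have h0 : Tendsto (fun N ↦ |w N * m|) atTop (𝓝 0) := by simpa using (hw0.mul_const m).abs
      refine squeeze_zero_norm (fun N ↦ ?_) h0
      rw [norm_mul, Real.norm_eq_abs, Real.norm_eq_abs, NNReal.abs_eq]
      exact mul_le_of_le_one_right (abs_nonneg _) (by exact_mod_cast hr1 N)
    have h2 := ((hy.const_mul v).add h1).neg
    rw [add_zero] at h2
    refine h2.congr fun N ↦ ?_
    simp only [hw]
    linear_combination (-(v / (σ * √(S N)) * m)) * hSr' N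
  simp only [hcf]
  have := (hmain.mul hrem).mul
    ((Complex.continuous_exp.tendsto _).comp
      (((Complex.continuous_ofReal.tendsto _).comp hphase).mul_const Complex.I))
  rw [charFun_gaussianReal]
  refine (this.congr fun N ↦ ?_).trans (le_of_eq ?_)
  · simp only [Function.comp_apply]
    push_cast
    rfl
  · rw [mul_one, ← Complex.exp_add]
    congr 2
    push_cast
    ring

/-- The central limit theorem for the tilted Lévy process, for distribution functions. -/
theorem tendsto_tilted_le (hξ : IsLevyProcess ξ P)
    (hfin : ∀ u : ℝ, Integrable (fun ω ↦ Real.exp (u * ξ 1 ω)) P)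
    (hconst : ¬ ∃ a : ℝ, ∀ᵐ ω ∂P, ξ 1 ω = a) (u : ℝ) {S : ℕ → ℝ≥0} {y : ℕ → ℝ} {x : ℝ}
    (hS : Tendsto (fun N ↦ (S N : ℝ)) atTop atTop)
    (hy : Tendsto (fun N ↦ (y N - deriv (psi ξ P) u * S N) /
      (√(iteratedDeriv 2 (psi ξ P) u) * √(S N))) atTop (𝓝 x)) :
    Tendsto (fun N ↦ (P.tilted (u * ξ (S N) ·)).real {ω | ξ (S N) ω ≤ y N}) atTop
      (𝓝 (cdf (gaussianReal 0 1) x)) := by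
  have hcf := hξ.tendsto_charFun_tilted_normalized hfin hconst u hS hy
  set σ := √(iteratedDeriv 2 (psi ξ P) u)
  have hσ : 0 < σ := Real.sqrt_pos.2 (hξ.iteratedDeriv_two_psi_pos hfin hconst u)
  have hprob (N) := hξ.isProbabilityMeasure_tilted hfin (S N) u
  have hm (N) : Measurable fun ω ↦ (ξ (S N) ω - y N) / (σ * √(S N)) :=
    ((hξ.measurable _).sub_const _).div_const _
  let ρ (N : ℕ) : ProbabilityMeasure ℝ := ⟨(P.tilted (u * ξ (S N) ·)).map fun ω ↦
      (ξ (S N) ω - y N) / (σ * √(S N)), Measure.isProbabilityMeasure_map (hm N).aemeasurable⟩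
  let γ : ProbabilityMeasure ℝ := ⟨gaussianReal (-x) 1, inferInstance⟩
  have hconv : Tendsto ρ atTop (𝓝 γ) := ProbabilityMeasure.tendsto_iff_tendsto_charFun.2 hcf
  -- For `S N > 0` the event `ξ ≤ y` says that the normalized variable is at most 0, a point that is
  -- not an atom of the Gaussian limit centred at `-x`.
  have hfr := ProbabilityMeasure.tendsto_measure_of_null_frontier_of_tendsto' hconv
    (E := Set.Iic 0) (by
      rw [frontier_Iic]
      have := nullSingletonClass_gaussianReal (μ := -x) (v := 1) (by simp)
      exact measure_singleton (μ := gaussianReal (-x) 1) (0 : ℝ))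
  have h1 := (ENNReal.tendsto_toReal (measure_ne_top (γ : Measure ℝ) _)).comp hfr
  have h2 : ((γ : Measure ℝ) (Set.Iic 0)).toReal = cdf (gaussianReal 0 1) x :=
    gaussianReal_neg_one_Iic_zero x
  rw [h2] at h1
  refine h1.congr' ?_
  filter_upwards [hS.eventually_gt_atTop 0] with N hN
  have hpos : 0 < σ * √(S N) := mul_pos hσ (Real.sqrt_pos.2 hN)
  simp only [Function.comp_apply, ρ, ProbabilityMeasure.coe_mk]
  rw [Measure.map_apply (hm N) measurableSet_Iic, Measure.real]
  congr 2
  ext ω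
  simp [div_le_iff₀ hpos]

end IsLevyProcess

/-! ### Integrals along laws whose mass escapes to both infinities. -/

theorem exists_norm_le_of_tendsto {G : ℝ → ℂ} (hG : Continuous G) {a b : ℂ}
    (ha : Tendsto G atBot (𝓝 a)) (hb : Tendsto G atTop (𝓝 b)) : ∃ K, ∀ y, ‖G y‖ ≤ K := by
  obtain ⟨y₁, h₁⟩ := eventually_atBot.1 (ha.norm.eventually_le_const (lt_add_one ‖a‖))
  obtain ⟨y₂, h₂⟩ := eventually_atTop.1 (hb.norm.eventually_le_const (lt_add_one ‖b‖))
  obtain ⟨K, hK⟩ := (isCompact_Icc (a := y₁) (b := y₂)).exists_bound_of_continuousOn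
    hG.continuousOn
  refine ⟨max K (max (‖a‖ + 1) (‖b‖ + 1)), fun y ↦ ?_⟩
  rcases le_total y y₁ with h | h
  · exact (h₁ y h).trans ((le_max_left _ _).trans (le_max_right _ _))
  rcases le_total y₂ y with h' | h'
  · exact (h₂ y h').trans ((le_max_right _ _).trans (le_max_right _ _))
  · exact (hK y ⟨h, h'⟩).trans (le_max_left _ _)

/-- If the laws of `L N` split asymptotically into a mass `p` at `-∞` and a mass `1 - p` at `+∞`,
then the integrals of a function that vanishes at `+∞` converge to `p` times its value at `-∞`. -/
theorem tendsto_integral_of_escape {Ω : Type*} [MeasurableSpace Ω] {Q : ℕ → Measure Ω}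
    [∀ N, IsProbabilityMeasure (Q N)] {L : ℕ → Ω → ℝ} (hL : ∀ N, Measurable (L N)) {p : ℝ}
    (hp : ∀ y, Tendsto (fun N ↦ (Q N).real {ω | L N ω ≤ y}) atTop (𝓝 p))
    {G : ℝ → ℂ} (hG : Continuous G) {a : ℂ}
    (ha : Tendsto G atBot (𝓝 a)) (hb : Tendsto G atTop (𝓝 0)) :
    Tendsto (fun N ↦ ∫ ω, G (L N ω) ∂(Q N)) atTop (𝓝 (p * a)) := by
  obtain ⟨K, hK⟩ := exists_norm_le_of_tendsto hG ha hb
  have hmeas (N y) : MeasurableSet {ω | L N ω ≤ y} := hL N measurableSet_Iic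
  -- Subtracting the step function leaves `F` vanishing at both ends, while the mass of a bounded
  -- window `(y₁, y₂]` tends to `p - p = 0`.
  set F : ℝ → ℂ := fun y ↦ G y - (Set.Iic 0).indicator (fun _ ↦ a) y with hF
  have hFm : Measurable F := hG.measurable.sub (measurable_const.indicator measurableSet_Iic)
  have hFK (y) : ‖F y‖ ≤ K + ‖a‖ :=
    (norm_sub_le _ _).trans (add_le_add (hK y) (norm_indicator_le_norm_self (fun _ ↦ a) y))
  have hFa : Tendsto F atBot (𝓝 0) := by
    rw [← sub_self a]
    refine (ha.sub_const a).congr' ?_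
    filter_upwards [eventually_le_atBot 0] with y hy
    simp [hF, hy]
  have hFb : Tendsto F atTop (𝓝 0) := by
    refine hb.congr' ?_
    filter_upwards [eventually_gt_atTop 0] with y hy
    simp [hF, hy]
  have hFint (N) : Integrable (fun ω ↦ F (L N ω)) (Q N) :=
    Integrable.of_bound (hFm.comp (hL N)).aestronglyMeasurable (K + ‖a‖)
      (ae_of_all _ fun ω ↦ hFK _)
  have hsplit (N) : ∫ ω, G (L N ω) ∂(Q N) =
      ∫ ω, F (L N ω) ∂(Q N) + (Q N).real {ω | L N ω ≤ 0} * a := by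
    have h1 : ∫ ω, {ω | L N ω ≤ 0}.indicator (fun _ ↦ a) ω ∂(Q N) =
        (Q N).real {ω | L N ω ≤ 0} * a := by
      rw [integral_indicator (hmeas N 0), setIntegral_const, Complex.real_smul]
    rw [← h1, ← integral_add (hFint N) ((integrable_const a).indicator (hmeas N 0))]
    refine integral_congr_ae (ae_of_all _ fun ω ↦ ?_)
    simp [hF, Set.indicator]
  simp only [hsplit]
  have hlim : Tendsto (fun N ↦ ∫ ω, F (L N ω) ∂(Q N)) atTop (𝓝 0) := by
    rw [tendsto_zero_iff_norm_tendsto_zero]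
    refine tendsto_order.2 ⟨fun b hb ↦ Eventually.of_forall fun N ↦ hb.trans_le (norm_nonneg _),
      fun ε hε ↦ ?_⟩
    have hε2 : (0 : ℝ) < ε / 2 := half_pos hε
    have hFa' := hFa.norm
    have hFb' := hFb.norm
    rw [norm_zero] at hFa' hFb'
    obtain ⟨y₁, h₁⟩ := eventually_atBot.1 (hFa'.eventually_le_const hε2)
    obtain ⟨y₂, h₂⟩ := eventually_atTop.1 (hFb'.eventually_le_const hε2)
    have hbd (N) (hN : y₁ ≤ y₂) : ‖∫ ω, F (L N ω) ∂(Q N)‖ ≤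
        ε / 2 + (K + ‖a‖) * ((Q N).real {ω | L N ω ≤ y₂} - (Q N).real {ω | L N ω ≤ y₁}) := by
      have hsub : {ω | L N ω ≤ y₁} ⊆ {ω | L N ω ≤ y₂} := fun ω hω ↦ le_trans hω hN
      have hD : MeasurableSet ({ω | L N ω ≤ y₂} \ {ω | L N ω ≤ y₁}) :=
        (hmeas N y₂).diff (hmeas N y₁)
      rw [← measureReal_sdiff hsub (hmeas N y₁)]
      have hi : Integrable (fun ω ↦ ε / 2 + ({ω | L N ω ≤ y₂} \ {ω | L N ω ≤ y₁}).indicator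
          (fun _ ↦ K + ‖a‖) ω) (Q N) :=
        (integrable_const _).add ((integrable_const _).indicator hD)
      refine (norm_integral_le_of_norm_le hi (ae_of_all _ fun ω ↦ ?_)).trans (le_of_eq ?_)
      · by_cases hω₁ : L N ω ≤ y₁
        · simpa [hω₁] using h₁ _ hω₁
        · by_cases hω₂ : L N ω ≤ y₂
          · simp only [Set.indicator, Set.mem_sdiff, Set.mem_ofPred_eq, hω₁, hω₂, not_false_eq_true,
              and_self, if_true]
            linarith [hFK (L N ω)]
          · simpa [hω₂] using h₂ _ (not_le.1 hω₂).le
      · rw [integral_add (integrable_const _) ((integrable_const _).indicator hD),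
          integral_indicator hD, setIntegral_const]
        simp [mul_comm]
    -- The maximum covers the case `y₂ ≤ y₁`, where `F` is small everywhere.
    have hbd' (N) : ‖∫ ω, F (L N ω) ∂(Q N)‖ ≤ ε / 2 + (K + ‖a‖) *
        ((Q N).real {ω | L N ω ≤ max y₁ y₂} - (Q N).real {ω | L N ω ≤ y₁}) := by
      rcases le_total y₁ y₂ with h | h
      · rw [max_eq_right h]; exact hbd N h
      · rw [max_eq_left h, sub_self, mul_zero, add_zero]
        have hall (y) : ‖F y‖ ≤ ε / 2 := by
          rcases le_total y y₁ with h' | h'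
          · exact h₁ y h'
          · exact h₂ y (h.trans h')
        have := norm_integral_le_of_norm_le_const (μ := Q N)
          (ae_of_all _ fun ω ↦ hall (L N ω))
        simpa using this
    have hlim2 := ((((hp (max y₁ y₂)).sub (hp y₁)).const_mul (K + ‖a‖)).const_add (ε / 2))
    rw [sub_self, mul_zero, add_zero] at hlim2
    filter_upwards [hlim2.eventually_lt_const (half_lt_self hε)] with N hN
    exact (hbd' N).trans_lt hN
  have h2 := hlim.add (((Complex.continuous_ofReal.tendsto _).comp (hp 0)).mul_const a)
  rw [zero_add] at h2
  exact h2

/-! ### Taylor quotient and powers of characteristic functions. -/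

/-- The second order Taylor remainder quotient of a characteristic function in logarithmic scale. -/
noncomputable def charFunQuotient (κ : Measure ℝ) (y : ℝ) : ℂ :=
  (charFun κ (Real.exp y) - 1 - Real.exp y * (∫ x, x ∂κ : ℝ) * Complex.I) / (Real.exp y : ℂ) ^ 2

theorem continuous_charFunQuotient (κ : Measure ℝ) [IsProbabilityMeasure κ] :
    Continuous (charFunQuotient κ) := by
  unfold charFunQuotient
  have h1 : Continuous fun y ↦ charFun κ (Real.exp y) := continuous_charFun.comp Real.continuous_exp
  refine Continuous.div (by fun_prop) (by fun_prop) fun y ↦ ?_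
  exact pow_ne_zero _ (by exact_mod_cast (Real.exp_pos y).ne')

theorem tendsto_charFunQuotient_atBot {κ : Measure ℝ} [IsProbabilityMeasure κ]
    (hκ : MemLp id 2 κ) :
    Tendsto (charFunQuotient κ) atBot (𝓝 (-((∫ x, x ^ 2 ∂κ : ℝ) : ℂ) / 2)) := by
  have h1 := taylor_isLittleO_univ (x₀ := 0)
    (contDiff_charFun (μ := κ) (n := 2) (by exact_mod_cast hκ))
  have h2 (t : ℝ) := taylorWithinEval_charFun_two_zero (P := κ) (X := id) aemeasurable_id
    (by simpa using hκ) t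
  simp only [Measure.map_id] at h2
  simp only [h2, sub_zero, id, Pi.pow_apply] at h1
  have h1' : _ =o[𝓝 0] fun v : ℝ ↦ ((v ^ 2 : ℝ) : ℂ) := Complex.isLittleO_ofReal_right.2 h1
  have h3 := h1'.tendsto_div_nhds_zero.comp Real.tendsto_exp_atBot
  have h4 := h3.sub_const (((∫ x, x ^ 2 ∂κ : ℝ) : ℂ) / 2)
  refine (h4.congr fun y ↦ ?_).trans (le_of_eq (by congr 1; ring))
  have h5 : (Real.exp y : ℂ) ≠ 0 := by exact_mod_cast (Real.exp_pos y).ne'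
  simp only [Function.comp_apply, charFunQuotient, Complex.ofReal_pow]
  field_simp
  ring

/-- The numerator grows at most linearly in `exp y`, the denominator quadratically. -/
theorem tendsto_charFunQuotient_atTop (κ : Measure ℝ) [IsProbabilityMeasure κ] :
    Tendsto (charFunQuotient κ) atTop (𝓝 0) := by
  have h0 : Tendsto (fun y ↦ (Real.exp y)⁻¹) atTop (𝓝 0) :=
    tendsto_inv_atTop_zero.comp Real.tendsto_exp_atTop
  have h1 := ((h0.pow 2).const_mul 2).add (h0.const_mul |∫ x, x ∂κ|)
  simp only [ne_eq, OfNat.ofNat_ne_zero, not_false_eq_true, zero_pow, mul_zero, add_zero] at h1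
  refine squeeze_zero_norm (fun y ↦ ?_) h1
  have hy := Real.exp_pos y
  rw [charFunQuotient, norm_div, norm_pow, Complex.norm_real, Real.norm_eq_abs, abs_of_pos hy]
  have h2 : ‖charFun κ (Real.exp y) - 1 - Real.exp y * (∫ x, x ∂κ : ℝ) * Complex.I‖ ≤
      2 + Real.exp y * |∫ x, x ∂κ| := by
    refine (norm_sub_le _ _).trans (add_le_add ?_ ?_)
    · rw [norm_sub_rev]; exact norm_one_sub_charFun_le_two
    · rw [norm_mul, norm_mul, Complex.norm_I, mul_one, Complex.norm_real, Complex.norm_real,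
        Real.norm_eq_abs, Real.norm_eq_abs, abs_of_pos hy]
  calc _ ≤ (2 + Real.exp y * |∫ x, x ∂κ|) / Real.exp y ^ 2 := by gcongr
    _ = _ := by field_simp

/-- Since `exp(im) = 1 + im + O(m²)` and `N m² → 0`, the base is `1 + (L + o(1)) / N`. -/
theorem tendsto_centered_pow {φ : ℕ → ℂ} {m : ℕ → ℝ} {L : ℂ}
    (hφ : Tendsto (fun N : ℕ ↦ N * (φ N - 1 - m N * Complex.I)) atTop (𝓝 L))
    (hm : Tendsto (fun N : ℕ ↦ N * m N ^ 2) atTop (𝓝 0)) :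
    Tendsto (fun N ↦ (φ N * Complex.exp (-(m N * Complex.I))) ^ N) atTop (𝓝 (Complex.exp L)) := by
  have hm2 : Tendsto (fun N ↦ m N ^ 2) atTop (𝓝 0) := by
    refine squeeze_zero' (Eventually.of_forall fun N ↦ sq_nonneg _) ?_ hm
    filter_upwards [eventually_ge_atTop 1] with N hN
    exact le_mul_of_one_le_left (sq_nonneg _) (by exact_mod_cast hN)
  have hm0 : Tendsto m atTop (𝓝 0) := by
    have := hm2.sqrt
    simp only [Real.sqrt_sq_eq_abs, Real.sqrt_zero] at this
    exact (tendsto_zero_iff_abs_tendsto_zero _).2 this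
  have hmI : Tendsto (fun N ↦ -((m N : ℂ) * Complex.I)) atTop (𝓝 0) := by
    simpa using (((Complex.continuous_ofReal.tendsto _).comp hm0).mul_const Complex.I).neg
  have hexp : Tendsto (fun N ↦ Complex.exp (-((m N : ℂ) * Complex.I))) atTop (𝓝 1) := by
    rw [← Complex.exp_zero]
    exact (Complex.continuous_exp.tendsto _).comp hmI
  have hrem : Tendsto (fun N : ℕ ↦ (N : ℂ) * (1 + m N * Complex.I - Complex.exp (m N * Complex.I)))
      atTop (𝓝 0) := by
    refine squeeze_zero_norm' ?_ hm
    filter_upwards [hm0.abs.eventually_le_const (show |(0 : ℝ)| < 1 by simp)] with N hN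
    have h1 : ‖(m N : ℂ) * Complex.I‖ = |m N| := by simp
    have h2 := Complex.norm_exp_sub_one_sub_id_le (h1 ▸ hN)
    rw [h1, sq_abs] at h2
    rw [norm_mul, Complex.norm_natCast]
    refine mul_le_mul_of_nonneg_left ?_ (Nat.cast_nonneg N)
    rw [norm_sub_rev, ← sub_sub]
    exact h2
  have h1 := (hφ.add hrem).mul hexp
  rw [add_zero, mul_one] at h1
  have h2 := Complex.tendsto_one_add_pow_exp_of_tendsto
    (g := fun N ↦ φ N * Complex.exp (-(m N * Complex.I)) - 1) (t := L) (h1.congr fun N ↦ ?_)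
  · simpa using h2
  · have h3 : Complex.exp (m N * Complex.I) * Complex.exp (-(m N * Complex.I)) = 1 := by
      rw [← Complex.exp_add, add_neg_cancel, Complex.exp_zero]
    linear_combination (-(N : ℂ)) * h3

/-- The characteristic function of a product of independent variables, by conditioning on the
first factor. -/
theorem integral_exp_mul_eq_integral_charFun {Ω : Type*} [MeasurableSpace Ω] {P : Measure Ω}
    [IsProbabilityMeasure P] {W D : Ω → ℝ} (hW : Measurable W) (hD : Measurable D)
    (h : IndepFun W D P) :
    ∫ ω, Complex.exp ((W ω * D ω : ℝ) * Complex.I) ∂P = ∫ ω, charFun (P.map D) (W ω) ∂P := by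
  have hmap := (indepFun_iff_map_prod_eq_prod_map_map hW.aemeasurable hD.aemeasurable).1 h
  have := Measure.isProbabilityMeasure_map (μ := P) hW.aemeasurable
  have := Measure.isProbabilityMeasure_map (μ := P) hD.aemeasurable
  have hf : Measurable fun p : ℝ × ℝ ↦ Complex.exp ((p.1 * p.2 : ℝ) * Complex.I) := by fun_prop
  have h1 : ∫ ω, Complex.exp ((W ω * D ω : ℝ) * Complex.I) ∂P =
      ∫ p, Complex.exp ((p.1 * p.2 : ℝ) * Complex.I) ∂((P.map W).prod (P.map D)) := by
    rw [← hmap, integral_map (hW.prodMk hD).aemeasurable hf.aestronglyMeasurable]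
  rw [h1, integral_prod, ← integral_map (f := charFun (P.map D)) hW.aemeasurable
    measurable_charFun.aestronglyMeasurable]
  · refine integral_congr_ae (ae_of_all _ fun w ↦ ?_)
    simp only [charFun_apply_real]
    push_cast
    rfl
  · refine Integrable.of_bound hf.aestronglyMeasurable 1 (ae_of_all _ fun p ↦ ?_)
    rw [Complex.norm_exp_ofReal_mul_I]

/-! ### Second moments and the characteristic function of one row. -/

namespace IsLevyProcess

variable {Ω : Type*} [MeasurableSpace Ω] {ξ : ℝ≥0 → Ω → ℝ} {P : Measure Ω}
  [IsProbabilityMeasure P]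

theorem memLp_exp (hξ : IsLevyProcess ξ P)
    (hfin : ∀ u : ℝ, Integrable (fun ω ↦ Real.exp (u * ξ 1 ω)) P) (s : ℝ≥0) :
    MemLp (fun ω ↦ Real.exp (ξ s ω)) 2 P := by
  rw [memLp_two_iff_integrable_sq (hξ.measurable s).exp.aestronglyMeasurable]
  refine (hξ.integrable_exp hfin s 2).congr (ae_of_all _ fun ω ↦ ?_)
  simp only [← Real.exp_nat_mul]; norm_num

theorem integral_exp (hξ : IsLevyProcess ξ P)
    (hfin : ∀ u : ℝ, Integrable (fun ω ↦ Real.exp (u * ξ 1 ω)) P) (s : ℝ≥0) :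
    ∫ ω, Real.exp (ξ s ω) ∂P = Real.exp (psi ξ P 1 * s) := by
  rw [← hξ.mgf_eq hfin]; simp [mgf]

theorem integral_exp_mul_exp_of_le (hξ : IsLevyProcess ξ P)
    (hfin : ∀ u : ℝ, Integrable (fun ω ↦ Real.exp (u * ξ 1 ω)) P) {s t : ℝ≥0} (h : s ≤ t) :
    ∫ ω, Real.exp (ξ s ω) * Real.exp (ξ t ω) ∂P =
      Real.exp (psi ξ P 2 / 2 * (s + t) - (psi ξ P 2 / 2 - psi ξ P 1) * |(t : ℝ) - s|) := by
  obtain ⟨r, rfl⟩ := exists_add_of_le h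
  have h1 := (hξ.indepFun_sub s r).integral_fun_comp_mul_comp
    (f := fun x : ℝ ↦ Real.exp (2 * x)) (g := fun x : ℝ ↦ Real.exp x)
    (hξ.measurable s).aemeasurable ((hξ.measurable _).sub (hξ.measurable s)).aemeasurable
    (by fun_prop) (by fun_prop)
  have h2 : ∫ ω, Real.exp ((ξ (s + r) - ξ s) ω) ∂P = Real.exp (psi ξ P 1 * r) := by
    have := (hξ.stationary s r).comp (u := Real.exp) (by fun_prop)
    rw [← hξ.integral_exp hfin]
    exact this.integral_eq
  have h3 : ∫ ω, Real.exp (2 * ξ s ω) ∂P = Real.exp (psi ξ P 2 * s) := hξ.mgf_eq hfin s 2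
  rw [h2, h3, ← Real.exp_add] at h1
  refine Eq.trans (integral_congr_ae (ae_of_all _ fun ω ↦ ?_)) (h1.trans ?_)
  · simp only [Pi.sub_apply]
    rw [← Real.exp_add, ← Real.exp_add]
    ring_nf
  · congr 1
    rw [NNReal.coe_add, add_sub_cancel_left, NNReal.abs_eq]
    ring

/-- The mixed second moments of the exponential of a Lévy process. -/
theorem integral_exp_mul_exp (hξ : IsLevyProcess ξ P)
    (hfin : ∀ u : ℝ, Integrable (fun ω ↦ Real.exp (u * ξ 1 ω)) P) (s t : ℝ≥0) :
    ∫ ω, Real.exp (ξ s ω) * Real.exp (ξ t ω) ∂P =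
      Real.exp (psi ξ P 2 / 2 * (s + t) - (psi ξ P 2 / 2 - psi ξ P 1) * |(t : ℝ) - s|) := by
  rcases le_total s t with h | h
  · exact hξ.integral_exp_mul_exp_of_le hfin h
  · simp only [mul_comm (Real.exp (ξ s _)), add_comm (s : ℝ), abs_sub_comm (t : ℝ)]
    exact hξ.integral_exp_mul_exp_of_le hfin h

/-- The asymptotic distribution of the logarithm of a summand under the tilted measure. -/
theorem tendsto_tilted_log_le (hξ : IsLevyProcess ξ P)
    (hfin : ∀ u : ℝ, Integrable (fun ω ↦ Real.exp (u * ξ 1 ω)) P)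
    (hconst : ¬ ∃ a : ℝ, ∀ᵐ ω ∂P, ξ 1 ω = a) {S : ℕ → ℝ≥0} {θ : ℝ}
    (hS : Tendsto (fun N ↦ (S N : ℝ)) atTop atTop)
    (hcrit : (fun N : ℕ ↦ Real.log N -
        (lambdaTwo ξ P * S N + 2 * θ * √(iteratedDeriv 2 (psi ξ P) 2 * S N)))
      =o[atTop] fun N ↦ √(S N)) (y : ℝ) :
    Tendsto (fun N ↦ (P.tilted (2 * ξ (S N) ·)).real
      {ω | ξ (S N) ω - (Real.log N + psi ξ P 2 * S N) / 2 ≤ y}) atTop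
      (𝓝 (cdf (gaussianReal 0 1) θ)) := by
  have hσ2 := hξ.iteratedDeriv_two_psi_pos hfin hconst 2
  have hσ : 0 < √(iteratedDeriv 2 (psi ξ P) 2) := Real.sqrt_pos.2 hσ2
  have hs : Tendsto (fun N ↦ √(S N)) atTop atTop := Real.tendsto_sqrt_atTop.comp hS
  have h := hξ.tendsto_tilted_le hfin hconst 2 hS (x := θ)
    (y := fun N ↦ y + (Real.log N + psi ξ P 2 * S N) / 2) ?_
  · refine h.congr fun N ↦ ?_
    simp only [sub_le_iff_le_add]
  -- `(log N + ψ(2) S)/2 - ψ'(2) S = (log N - λ₂ S)/2`, which by critical growth is `θ √(ψ''(2) S) +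
  -- o(√S)`; the fixed `y` is negligible.
  · have h1 := hcrit.tendsto_div_nhds_zero
    have h2 : Tendsto (fun N ↦ y / √(S N)) atTop (𝓝 0) := hs.const_div_atTop y
    have h3 := ((((h1.div_const 2).add h2).div_const (√(iteratedDeriv 2 (psi ξ P) 2))).const_add θ)
    simp only [zero_div, add_zero] at h3
    refine h3.congr' ?_
    filter_upwards [hs.eventually_gt_atTop 0] with N hN
    rw [Real.sqrt_mul hσ2.le, lambdaTwo]
    field_simp
    ring

/-- The characteristic function of the normalized sum of `N` independent copies of
`∑ k, c k * exp (ξ (S N + h k))`. -/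
theorem tendsto_charFun_row (hξ : IsLevyProcess ξ P)
    (hfin : ∀ u : ℝ, Integrable (fun ω ↦ Real.exp (u * ξ 1 ω)) P)
    (hconst : ¬ ∃ a : ℝ, ∀ᵐ ω ∂P, ξ 1 ω = a) {S : ℕ → ℝ≥0} {θ : ℝ}
    (hS : Tendsto (fun N ↦ (S N : ℝ)) atTop atTop)
    (hcrit : (fun N : ℕ ↦ Real.log N -
        (lambdaTwo ξ P * S N + 2 * θ * √(iteratedDeriv 2 (psi ξ P) 2 * S N)))
      =o[atTop] fun N ↦ √(S N))
    {ι : Type*} [Fintype ι] (h : ι → ℝ≥0) (c : ι → ℝ) {V : ℕ → Ω → ℝ}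
    (hV : ∀ N ω, V N ω = (√(N * Real.exp (psi ξ P 2 * S N)))⁻¹ *
      ∑ k, c k * Real.exp (ξ (S N + h k) ω)) :
    Tendsto (fun N ↦ ((∫ ω, Complex.exp (V N ω * Complex.I) ∂P) *
        Complex.exp (-((∫ ω, V N ω ∂P : ℝ) * Complex.I))) ^ N) atTop
      (𝓝 (Complex.exp (-(cdf (gaussianReal 0 1) θ *
        ∫ ω, (∑ k, c k * Real.exp (ξ (h k) ω)) ^ 2 ∂P : ℝ) / 2))) := by
  set D : Ω → ℝ := fun ω ↦ ∑ k, c k * Real.exp (ξ (h k) ω) with hD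
  have hDm : Measurable D :=
    Finset.measurable_fun_sum _ fun k _ ↦ (hξ.measurable _).exp.const_mul _
  have hD2 : MemLp D 2 P := memLp_finsetSum _ fun k _ ↦ (hξ.memLp_exp hfin _).const_mul _
  set κ := P.map D with hκ
  have : IsProbabilityMeasure κ := Measure.isProbabilityMeasure_map hDm.aemeasurable
  have hκ2 : MemLp id 2 κ := by
    rw [hκ, memLp_map_measure_iff (by fun_prop) hDm.aemeasurable]; exact hD2
  have hκ1 : ∫ x, x ∂κ = ∫ ω, D ω ∂P := by
    rw [hκ, integral_map hDm.aemeasurable (by fun_prop)]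
  have hκsq : ∫ x, x ^ 2 ∂κ = ∫ ω, D ω ^ 2 ∂P := by
    rw [hκ, integral_map hDm.aemeasurable (by fun_prop)]
  set B : ℕ → ℝ := fun N ↦ √(N * Real.exp (psi ξ P 2 * S N)) with hB
  have hBpos (N : ℕ) (hN : 0 < N) : 0 < B N := by
    simp only [hB]; positivity
  have hB2 (N : ℕ) : B N ^ 2 = N * Real.exp (psi ξ P 2 * S N) := by
    simp only [hB]; rw [Real.sq_sqrt (by positivity)]
  set W : ℕ → Ω → ℝ := fun N ω ↦ (B N)⁻¹ * Real.exp (ξ (S N) ω) with hW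
  have hWm (N) : Measurable (W N) := (hξ.measurable _).exp.const_mul _
  -- `D' N` uses only increments after `S N`: it is independent of `W N` and has the law of `D` for
  -- every `N`.
  set D' : ℕ → Ω → ℝ := fun N ω ↦ ∑ k, c k * Real.exp (ξ (S N + h k) ω - ξ (S N) ω) with hD'
  have hD'm (N) : Measurable (D' N) := Finset.measurable_fun_sum _ fun k _ ↦
    ((hξ.measurable _).sub (hξ.measurable _)).exp.const_mul _
  have hC : Measurable fun y : ι → ℝ ↦ ∑ k, c k * Real.exp (y k) := by fun_prop
  have hVWD (N ω) : V N ω = W N ω * D' N ω := by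
    rw [hV]
    simp only [hW, hD', Finset.mul_sum]
    refine Finset.sum_congr rfl fun k _ ↦ ?_
    rw [Real.exp_sub]
    field_simp
    rfl
  have hind (N) : IndepFun (W N) (D' N) P :=
    (hξ.indepFun_increments h (S N)).comp
      (φ := fun x : ℝ ↦ (B N)⁻¹ * Real.exp x) (by fun_prop) hC
  have hid (N) : IdentDistrib (D' N) D P P := (hξ.identDistrib_increments h (S N)).comp hC
  have hWint (N) : ∫ ω, W N ω ∂P = (B N)⁻¹ * Real.exp (psi ξ P 1 * S N) := by
    simp only [hW]
    rw [integral_const_mul, hξ.integral_exp hfin]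
  have hWi (N) : Integrable (W N) P := ((hξ.memLp_exp hfin _).integrable (by norm_num)).const_mul _
  have hm (N) : ∫ ω, V N ω ∂P = (B N)⁻¹ * Real.exp (psi ξ P 1 * S N) * ∫ ω, D ω ∂P := by
    simp only [hVWD]
    rw [(hind N).integral_fun_mul_eq_mul_integral (hWm N).aestronglyMeasurable
      (hD'm N).aestronglyMeasurable, hWint, (hid N).integral_eq]
  have hφ (N) : ∫ ω, Complex.exp (V N ω * Complex.I) ∂P = ∫ ω, charFun κ (W N ω) ∂P := by
    simp only [hVWD]
    rw [integral_exp_mul_eq_integral_charFun (hWm N) (hD'm N) (hind N), (hid N).map_eq]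
  have hprob (N) := hξ.isProbabilityMeasure_tilted hfin (S N) 2
  have hlim := tendsto_integral_of_escape (Q := fun N ↦ P.tilted (2 * ξ (S N) ·))
    (L := fun N ω ↦ ξ (S N) ω - (Real.log N + psi ξ P 2 * S N) / 2)
    (fun N ↦ (hξ.measurable _).sub_const _)
    (hξ.tendsto_tilted_log_le hfin hconst hS hcrit) (continuous_charFunQuotient κ)
    (tendsto_charFunQuotient_atBot hκ2) (tendsto_charFunQuotient_atTop κ)
  refine (tendsto_centered_pow (hlim.congr' ?_) ?_).trans (le_of_eq ?_)
  · filter_upwards [eventually_gt_atTop 0] with N hN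
    have hN' : (0 : ℝ) < N := by exact_mod_cast hN
    have hWexp (ω) : Real.exp (ξ (S N) ω - (Real.log N + psi ξ P 2 * S N) / 2) = W N ω := by
      have h1 : B N = Real.exp ((Real.log N + psi ξ P 2 * S N) / 2) := by
        simp only [hB]
        rw [Real.sqrt_eq_iff_eq_sq (by positivity) (by positivity), ← Real.exp_nat_mul]
        push_cast
        rw [mul_div_cancel₀ _ two_ne_zero, Real.exp_add, Real.exp_log hN']
      simp only [hW]
      rw [Real.exp_sub, h1, div_eq_inv_mul]
    have hWpos (ω) : 0 < W N ω := mul_pos (inv_pos.2 (hBpos N hN)) (Real.exp_pos _)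
    rw [integral_tilted_mul_eq_mgf, hξ.mgf_eq hfin, hφ, hm, ← hWint]
    have hci : Integrable (fun ω ↦ charFun κ (W N ω)) P :=
      Integrable.of_bound (measurable_charFun.comp (hWm N)).aestronglyMeasurable 1
        (ae_of_all _ fun ω ↦ norm_charFun_le_one _)
    have e1 : ∫ ω, charFun κ (W N ω) ∂P - 1 -
        ((∫ ω, W N ω ∂P) * ∫ ω, D ω ∂P : ℝ) * Complex.I =
        ∫ ω, (charFun κ (W N ω) - 1 - W N ω * (∫ x, x ∂κ : ℝ) * Complex.I) ∂P := by
      have hc2 : Integrable (fun ω ↦ charFun κ (W N ω) - 1) P := hci.sub (integrable_const 1)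
      have hc3 : Integrable (fun ω ↦ (W N ω : ℂ) * (∫ x, x ∂κ : ℝ) * Complex.I) P :=
        ((hWi N).ofReal.mul_const _).mul_const _
      rw [integral_sub hc2 hc3, integral_sub hci (integrable_const 1)]
      simp only [mul_assoc]
      rw [integral_mul_const, integral_complex_ofReal, hκ1]
      simp [mul_assoc]
    rw [e1, ← integral_const_mul]
    refine integral_congr_ae (ae_of_all _ fun ω ↦ ?_)
    simp only [charFunQuotient, hWexp, Complex.real_smul]
    -- The tilting density is `N W²`, which cancels the squared denominator of the Taylor quotient
    -- at `log W`.
    have e2 : Real.exp (2 * ξ (S N) ω) / Real.exp (psi ξ P 2 * S N) = N * W N ω ^ 2 := by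
      simp only [hW]
      rw [mul_pow, inv_pow, hB2, ← Real.exp_nat_mul]
      push_cast
      field_simp
    rw [e2]
    have : (W N ω : ℂ) ≠ 0 := by exact_mod_cast (hWpos ω).ne'
    push_cast
    field_simp
  -- Here `N m² = exp ((2ψ(1) - ψ(2)) S) (E D)²`.
  · have hneg : 2 * psi ξ P 1 - psi ξ P 2 < 0 := by
      linarith [hξ.two_mul_psi_one_lt hfin hconst]
    have h1 : Tendsto (fun N ↦ Real.exp ((2 * psi ξ P 1 - psi ξ P 2) * S N) *
        (∫ ω, D ω ∂P) ^ 2) atTop (𝓝 0) := by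
      have := (Real.tendsto_exp_atBot.comp (hS.const_mul_atTop_of_neg hneg)).mul_const
        ((∫ ω, D ω ∂P) ^ 2)
      rwa [zero_mul] at this
    refine h1.congr' ?_
    filter_upwards [eventually_gt_atTop 0] with N hN
    have hN' : (0 : ℝ) < N := by exact_mod_cast hN
    rw [hm, mul_pow, mul_pow, inv_pow, hB2, sub_mul, Real.exp_sub, ← Real.exp_nat_mul]
    push_cast
    rw [mul_assoc 2]
    field_simp
  · congr 2
    rw [hκsq]
    push_cast
    ring

end IsLevyProcess

/-! ### Lévy continuity for vectors, and stability of the growth condition. -/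

theorem charFun_map_toLp {Ω ι : Type*} [Fintype ι] [MeasurableSpace Ω] {P : Measure Ω}
    {X : Ω → ι → ℝ} (hX : AEMeasurable X P) (v : EuclideanSpace ℝ ι) :
    charFun (P.map fun ω ↦ (WithLp.toLp 2 (X ω) : EuclideanSpace ℝ ι)) v =
      ∫ ω, Complex.exp ((∑ k, v k * X ω k : ℝ) * Complex.I) ∂P := by
  rw [charFun_apply, integral_map (by fun_prop) (by fun_prop)]
  refine integral_congr_ae (ae_of_all _ fun ω ↦ ?_)
  simp [PiLp.inner_apply]

/-- Convergence in distribution of random vectors follows from convergence of the joint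
characteristic functions. -/
theorem tendstoInDistribution_of_tendsto_integral_exp {Ω Ω' ι : Type*} [Fintype ι]
    [MeasurableSpace Ω] [MeasurableSpace Ω'] {P : Measure Ω} [IsProbabilityMeasure P]
    {P' : Measure Ω'} [IsProbabilityMeasure P'] {Y : ℕ → Ω → ι → ℝ} {Z : Ω' → ι → ℝ}
    (hY : ∀ N, AEMeasurable (Y N) P) (hZ : AEMeasurable Z P')
    (h : ∀ v : ι → ℝ, Tendsto
      (fun N ↦ ∫ ω, Complex.exp ((∑ k, v k * Y N ω k : ℝ) * Complex.I) ∂P) atTop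
      (𝓝 (∫ ω, Complex.exp ((∑ k, v k * Z ω k : ℝ) * Complex.I) ∂P'))) :
    TendstoInDistribution Y atTop Z (fun _ ↦ P) P' := by
  -- Characteristic functions require an inner product, so the vectors pass through `EuclideanSpace`
  -- and return by continuous mapping.
  have h1 : TendstoInDistribution (fun N ω ↦ (WithLp.toLp 2 (Y N ω) : EuclideanSpace ℝ ι)) atTop
      (fun ω ↦ WithLp.toLp 2 (Z ω)) (fun _ ↦ P) P' := by
    refine ⟨fun N ↦ by have := hY N; fun_prop, by fun_prop, ?_⟩
    refine ProbabilityMeasure.tendsto_iff_tendsto_charFun.2 fun v ↦ ?_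
    have h2 := h v
    rw [← charFun_map_toLp hZ v] at h2
    exact h2.congr fun N ↦ (charFun_map_toLp (hY N) v).symm
  exact h1.continuous_comp (g := fun x : EuclideanSpace ℝ ι ↦ x.ofLp) (by fun_prop)

/-- `log N` is unbounded, yet eventually at most `C (1 + s N)`. -/
theorem tendsto_atTop_of_log_isLittleO {s : ℕ → ℝ} (hs : ∀ N, 0 ≤ s N) {a b c : ℝ}
    (h : (fun N : ℕ ↦ Real.log N - (a * s N + b * √(c * s N))) =o[atTop] fun N ↦ √(s N)) :
    Tendsto s atTop atTop := by
  have hlog : Tendsto (fun N : ℕ ↦ Real.log N) atTop atTop :=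
    Real.tendsto_log_atTop.comp tendsto_natCast_atTop_atTop
  set C := |a| + |b| * √|c| + 1 with hC
  have hCpos : 0 < C := by positivity
  have h1 : Tendsto (fun N : ℕ ↦ C⁻¹ * Real.log N - 1) atTop atTop :=
    tendsto_atTop_add_const_right _ _ (hlog.const_mul_atTop (inv_pos.2 hCpos))
  refine tendsto_atTop_mono' _ ?_ h1
  filter_upwards [h.bound zero_lt_one] with N hN
  have hsN := hs N
  have hsq : √(s N) ≤ 1 + s N := by
    rw [Real.sqrt_le_left (by linarith)]; nlinarith
  rw [one_mul, Real.norm_eq_abs, Real.norm_eq_abs, abs_of_nonneg (Real.sqrt_nonneg _)] at hN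
  have h2 := (le_abs_self _).trans hN
  have h3 : a * s N ≤ |a| * (1 + s N) := by
    nlinarith [le_abs_self a, abs_nonneg a, mul_le_mul_of_nonneg_right (le_abs_self a) hsN]
  have h4 : b * √(c * s N) ≤ |b| * √|c| * (1 + s N) := by
    have h5 : √(c * s N) ≤ √|c| * √(s N) := by
      rw [← Real.sqrt_mul (abs_nonneg c)]
      exact Real.sqrt_le_sqrt (mul_le_mul_of_nonneg_right (le_abs_self c) hsN)
    calc b * √(c * s N) ≤ |b| * √(c * s N) :=
          mul_le_mul_of_nonneg_right (le_abs_self b) (Real.sqrt_nonneg _)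
      _ ≤ |b| * (√|c| * (1 + s N)) := by
          refine mul_le_mul_of_nonneg_left (h5.trans ?_) (abs_nonneg b)
          exact mul_le_mul_of_nonneg_left hsq (Real.sqrt_nonneg _)
      _ = _ := by ring
  rw [sub_le_iff_le_add, inv_mul_le_iff₀ hCpos]
  rw [hC]
  linarith

/-- The critical growth condition is invariant under a shift of time. -/
theorem isLittleO_critical_shift {s S : ℕ → ℝ} {t a b c : ℝ} {f : ℕ → ℝ}
    (hc : 0 ≤ c) (hs : Tendsto s atTop atTop) (hS : ∀ᶠ N in atTop, S N = s N + t)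
    (h : (fun N : ℕ ↦ f N - (a * s N + b * √(c * s N))) =o[atTop] fun N ↦ √(s N)) :
    (fun N : ℕ ↦ f N - (a * S N + b * √(c * S N))) =o[atTop] fun N ↦ √(S N) := by
  have hS' : Tendsto S atTop atTop :=
    (tendsto_atTop_add_const_right _ t hs).congr' (hS.mono fun _ h ↦ h.symm)
  have hsS : (fun N ↦ √(s N)) =O[atTop] fun N ↦ √(S N) := by
    refine IsBigO.of_bound √2 ?_
    -- Once `s ≥ 2|t|`, one has `s ≤ 2 (s + t)`.
    filter_upwards [hS, hs.eventually_ge_atTop (2 * |t|)] with N hN h2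
    rw [Real.norm_eq_abs, Real.norm_eq_abs, abs_of_nonneg (Real.sqrt_nonneg _),
      abs_of_nonneg (Real.sqrt_nonneg _), ← Real.sqrt_mul zero_le_two]
    refine Real.sqrt_le_sqrt ?_
    rw [hN]
    linarith [neg_abs_le t]
  have hone : (fun _ : ℕ ↦ (1 : ℝ)) =o[atTop] fun N ↦ √(S N) := by
    refine isLittleO_const_left.2 (Or.inr ?_)
    exact tendsto_norm_atTop_atTop.comp (Real.tendsto_sqrt_atTop.comp hS')
  have hdiff : (fun N ↦ a * (s N - S N) + b * √c * (√(s N) - √(S N))) =O[atTop]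
      fun _ : ℕ ↦ (1 : ℝ) := by
    refine IsBigO.of_bound (|a| * |t| + |b * √c| * |t|) ?_
    filter_upwards [hS, hs.eventually_ge_atTop 1, hS'.eventually_ge_atTop 0] with N hN h1 h0
    have h2 : |√(s N) - √(S N)| ≤ |t| := by
      have h3 : 1 ≤ √(s N) + √(S N) := by
        linarith [Real.one_le_sqrt.2 h1, Real.sqrt_nonneg (S N)]
      have h4 : (√(s N) - √(S N)) * (√(s N) + √(S N)) = -t := by
        have h5 := Real.mul_self_sqrt (show 0 ≤ s N by linarith)
        have h6 := Real.mul_self_sqrt h0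
        linear_combination h5 - h6 - hN
      rw [← abs_neg t, ← h4, abs_mul]
      exact le_mul_of_one_le_right (abs_nonneg _) (h3.trans (le_abs_self _))
    rw [norm_one, mul_one, Real.norm_eq_abs]
    refine (abs_add_le _ _).trans (add_le_add ?_ ?_)
    · rw [abs_mul, hN]; simp
    · rw [abs_mul]; exact mul_le_mul_of_nonneg_left h2 (abs_nonneg _)
  refine ((h.trans_isBigO hsS).add (hdiff.trans_isLittleO hone)).congr_left fun N ↦ ?_
  rw [Real.sqrt_mul hc, Real.sqrt_mul hc]
  ring

/-! ### The Gaussian limit, and moments of sums of independent copies. -/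

namespace IsOrnsteinUhlenbeck

variable {Ω : Type*} [MeasurableSpace Ω] {P : Measure Ω} {X : ℝ → Ω → ℝ} {c : ℝ}

theorem integral_exp_sum (hX : IsOrnsteinUhlenbeck c X P) {ι : Type*} [Fintype ι] (t : ι → ℝ)
    (a : ι → ℝ) :
    ∫ ω, Complex.exp ((∑ k, a k * X (t k) ω : ℝ) * Complex.I) ∂P =
      Complex.exp (-(∑ k, ∑ l, a k * a l * Real.exp (-c * |t l - t k|) : ℝ) / 2) := by
  have := hX.gaussian.isProbabilityMeasure
  have hG : HasGaussianLaw (fun ω ↦ ∑ k, a k * X (t k) ω) P := by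
    exact ((hX.gaussian.comp_right t).smul a).hasGaussianLaw_fun_sum (I := Finset.univ)
  have hm (k) : MemLp (X (t k)) 2 P := (hX.gaussian.hasGaussianLaw_eval _).memLp_two
  have hmean : ∫ ω, ∑ k, a k * X (t k) ω ∂P = 0 := by
    rw [integral_finsetSum _ fun k _ ↦ ((hm k).integrable (by norm_num)).const_mul _]
    simp [integral_const_mul, hX.mean]
  have hvar : Var[fun ω ↦ ∑ k, a k * X (t k) ω; P] =
      ∑ k, ∑ l, a k * a l * Real.exp (-c * |t l - t k|) := by
    rw [← covariance_self hG.aemeasurable, covariance_fun_sum_fun_sum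
      (fun k ↦ (hm k).const_mul _) (fun k ↦ (hm k).const_mul _)]
    refine Finset.sum_congr rfl fun k _ ↦ Finset.sum_congr rfl fun l _ ↦ ?_
    rw [covariance_const_mul_left, covariance_const_mul_right, hX.cov]
    ring
  have h1 : ∫ ω, Complex.exp ((∑ k, a k * X (t k) ω : ℝ) * Complex.I) ∂P =
      charFun (P.map fun ω ↦ ∑ k, a k * X (t k) ω) 1 := by
    rw [charFun_apply_real, integral_map hG.aemeasurable (by fun_prop)]
    simp
  rw [h1, hG.map_eq_gaussianReal, charFun_gaussianReal, hmean,
    Real.coe_toNNReal _ (variance_nonneg _ _), hvar]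
  congr 1
  simp
  ring

end IsOrnsteinUhlenbeck

namespace AreIndepCopies

variable {Ω Ω₀ : Type*} [MeasurableSpace Ω] [MeasurableSpace Ω₀] {ξs : ℕ → ℝ≥0 → Ω → ℝ}
  {P : Measure Ω} {ξ : ℝ≥0 → Ω₀ → ℝ} {P₀ : Measure Ω₀}

theorem identDistrib_apply (h : AreIndepCopies ξs P ξ P₀) (i : ℕ) (T : ℝ≥0) :
    IdentDistrib (ξs i T) (ξ T) P P₀ :=
  (h.identDistrib i).comp (measurable_pi_apply T)

theorem aemeasurable (h : AreIndepCopies ξs P ξ P₀) (i : ℕ) (T : ℝ≥0) :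
    AEMeasurable (ξs i T) P := (h.identDistrib_apply i T).aemeasurable_fst

theorem integral_prod_comp (h : AreIndepCopies ξs P ξ P₀) (N : ℕ) {f : (ℝ≥0 → ℝ) → ℂ}
    (hf : Measurable f) :
    ∫ ω, ∏ i ∈ Finset.range N, f (fun T ↦ ξs i T ω) ∂P =
      (∫ ω, f (fun T ↦ ξ T ω) ∂P₀) ^ N := by
  have h1 := (h.indep.precomp (g := fun i : Fin N ↦ (i : ℕ))
    Fin.val_injective).integral_fun_prod_comp (f := fun _ ↦ f)
      (fun i ↦ (h.identDistrib i).aemeasurable_fst) fun i ↦ hf.aestronglyMeasurable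
  have h2 (i : ℕ) : ∫ ω, f (fun T ↦ ξs i T ω) ∂P = ∫ ω, f (fun T ↦ ξ T ω) ∂P₀ :=
    ((h.identDistrib i).comp hf).integral_eq
  simp only [h2, Finset.prod_const, Finset.card_univ, Fintype.card_fin] at h1
  rw [← h1]
  refine integral_congr_ae (ae_of_all _ fun ω ↦ ?_)
  exact (Fin.prod_univ_eq_prod_range (fun i ↦ f (fun T ↦ ξs i T ω)) N).symm

theorem aemeasurable_sumProcess (h : AreIndepCopies ξs P ξ P₀) (s : ℕ → ℝ) (N : ℕ) (t : ℝ) :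
    AEMeasurable (sumProcess ξs s N t) P :=
  Finset.aemeasurable_fun_sum _ fun i _ ↦ (h.aemeasurable i _).exp

variable [IsProbabilityMeasure P₀]

theorem memLp_exp (h : AreIndepCopies ξs P ξ P₀) (hξ : IsLevyProcess ξ P₀)
    (hfin : ∀ u : ℝ, Integrable (fun ω ↦ Real.exp (u * ξ 1 ω)) P₀) (i : ℕ) (T : ℝ≥0) :
    MemLp (fun ω ↦ Real.exp (ξs i T ω)) 2 P :=
  ((h.identDistrib_apply i T).comp Real.measurable_exp).memLp_iff.2 (hξ.memLp_exp hfin T)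

theorem integral_sumProcess [IsProbabilityMeasure P] (h : AreIndepCopies ξs P ξ P₀)
    (hξ : IsLevyProcess ξ P₀)
    (hfin : ∀ u : ℝ, Integrable (fun ω ↦ Real.exp (u * ξ 1 ω)) P₀) (s : ℕ → ℝ) (N : ℕ) (t : ℝ) :
    ∫ ω, sumProcess ξs s N t ω ∂P = N * ∫ ω, Real.exp (ξ (s N + t).toNNReal ω) ∂P₀ := by
  simp only [sumProcess]
  rw [integral_finsetSum _ fun i _ ↦ (h.memLp_exp hξ hfin i _).integrable (by norm_num)]
  have (i : ℕ) : ∫ ω, Real.exp (ξs i (s N + t).toNNReal ω) ∂P =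
      ∫ ω, Real.exp (ξ (s N + t).toNNReal ω) ∂P₀ :=
    ((h.identDistrib_apply i _).comp Real.measurable_exp).integral_eq
  simp [this]

theorem variance_sumProcess (h : AreIndepCopies ξs P ξ P₀) (hξ : IsLevyProcess ξ P₀)
    (hfin : ∀ u : ℝ, Integrable (fun ω ↦ Real.exp (u * ξ 1 ω)) P₀) (s : ℕ → ℝ) (N : ℕ) (t : ℝ) :
    Var[sumProcess ξs s N t; P] = N * (Real.exp (psi ξ P₀ 2 * (s N + t).toNNReal) -
      Real.exp (2 * psi ξ P₀ 1 * (s N + t).toNNReal)) := by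
  set T := (s N + t).toNNReal
  have h1 : sumProcess ξs s N t = ∑ i ∈ Finset.range N, fun ω ↦ Real.exp (ξs i T ω) := by
    ext ω; simp [sumProcess, T]
  have h2 (i : ℕ) : Var[fun ω ↦ Real.exp (ξs i T ω); P] = Var[fun ω ↦ Real.exp (ξ T ω); P₀] :=
    ((h.identDistrib_apply i T).comp Real.measurable_exp).variance_eq
  have h3 : ∫ ω, ((fun ω ↦ Real.exp (ξ T ω)) ^ 2) ω ∂P₀ = Real.exp (psi ξ P₀ 2 * T) := by
    rw [← hξ.mgf_eq hfin]
    refine integral_congr_ae (ae_of_all _ fun ω ↦ ?_)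
    simp only [Pi.pow_apply, ← Real.exp_nat_mul]; norm_num
  rw [h1, IndepFun.variance_sum (fun i _ ↦ h.memLp_exp hξ hfin i T)]
  · simp only [h2, Finset.sum_const, Finset.card_range, nsmul_eq_mul]
    rw [variance_eq_sub (hξ.memLp_exp hfin T), h3, hξ.integral_exp hfin, ← Real.exp_nat_mul]
    push_cast
    rw [mul_assoc 2]
  · intro i _ j _ hij
    have hm : Measurable fun p : ℝ≥0 → ℝ ↦ Real.exp (p T) := (measurable_pi_apply T).exp
    exact (h.indep.indepFun hij).comp hm hm

end AreIndepCopies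

/-! ### Convergence of the finite-dimensional distributions. -/

/-- The ratio is `(1 - exp ((b - a) S))^(-1/2)` for `N > 0`: the squared mean is negligible in the
variance. -/
theorem tendsto_sqrt_div_sqrt_sub {S : ℕ → ℝ} (hS : Tendsto S atTop atTop) {a b : ℝ}
    (hab : b < a) : Tendsto (fun N : ℕ ↦ √(N * Real.exp (a * S N)) /
      √(N * (Real.exp (a * S N) - Real.exp (b * S N)))) atTop (𝓝 1) := by
  have h1 : Tendsto (fun N ↦ 1 - Real.exp ((b - a) * S N)) atTop (𝓝 1) := by
    have := (Real.tendsto_exp_atBot.comp (hS.const_mul_atTop_of_neg (sub_neg.2 hab))).const_sub 1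
    rwa [sub_zero] at this
  have h2 := (h1.inv₀ one_ne_zero).sqrt
  rw [inv_one, Real.sqrt_one] at h2
  refine h2.congr' ?_
  filter_upwards [eventually_gt_atTop 0] with N hN
  have hN' : (0 : ℝ) < N := by exact_mod_cast hN
  rw [← Real.sqrt_div (by positivity)]
  congr 1
  rw [sub_mul, Real.exp_sub, inv_eq_one_div, one_sub_div (Real.exp_pos _).ne', one_div_div]
  rw [mul_div_mul_left _ _ hN'.ne']

/-- Convergence of the characteristic functions of the finite-dimensional distributions. -/
theorem tendsto_integral_exp_sumProcess
    {Ω₀ : Type*} [MeasurableSpace Ω₀] {P₀ : Measure Ω₀} [IsProbabilityMeasure P₀]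
    {ξ : ℝ≥0 → Ω₀ → ℝ} (hξ : IsLevyProcess ξ P₀)
    (hfin : ∀ u : ℝ, Integrable (fun ω ↦ Real.exp (u * ξ 1 ω)) P₀)
    (hconst : ¬ ∃ a : ℝ, ∀ᵐ ω ∂P₀, ξ 1 ω = a)
    {Ω : Type*} [MeasurableSpace Ω] {P : Measure Ω} [IsProbabilityMeasure P]
    {ξs : ℕ → ℝ≥0 → Ω → ℝ} (hξs : AreIndepCopies ξs P ξ P₀)
    {s : ℕ → ℝ} (hs : Tendsto s atTop atTop) {θ : ℝ}
    (hcrit : (fun N : ℕ ↦ Real.log N -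
        (lambdaTwo ξ P₀ * s N + 2 * θ * √(iteratedDeriv 2 (psi ξ P₀) 2 * s N)))
      =o[atTop] fun N ↦ √(s N))
    {Ω' : Type*} [MeasurableSpace Ω'] {P' : Measure Ω'}
    {X : ℝ → Ω' → ℝ} (hX : IsOrnsteinUhlenbeck (psi ξ P₀ 2 / 2 - psi ξ P₀ 1) X P')
    {ι : Type*} [Fintype ι] (t : ι → ℝ) {t₀ : ℝ} (ht₀ : ∀ k, t₀ ≤ t k) (v : ι → ℝ) :
    Tendsto (fun N : ℕ ↦ ∫ ω, Complex.exp ((∑ k, v k *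
      ((sumProcess ξs s N (t k) ω - ∫ ω', sumProcess ξs s N (t k) ω' ∂P) /
        √(N * Real.exp (psi ξ P₀ 2 * (s N + t k)))) : ℝ) * Complex.I) ∂P) atTop
      (𝓝 (∫ ω, Complex.exp ((∑ k, v k * (√(cdf (gaussianReal 0 1) θ) * X (t k) ω) : ℝ) *
        Complex.I) ∂P')) := by
  -- A common base time before all `s N + t k`, with nonnegative lags `h k`; the truncation at 0 is
  -- inactive for large `N`.
  set S : ℕ → ℝ≥0 := fun N ↦ (s N + t₀).toNNReal with hSdef
  set h : ι → ℝ≥0 := fun k ↦ (t k - t₀).toNNReal with hh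
  have hhk (k) : (h k : ℝ) = t k - t₀ := Real.coe_toNNReal _ (sub_nonneg.2 (ht₀ k))
  have hst : Tendsto (fun N ↦ s N + t₀) atTop atTop := tendsto_atTop_add_const_right _ t₀ hs
  have hSe : ∀ᶠ N in atTop, (S N : ℝ) = s N + t₀ := by
    filter_upwards [hst.eventually_ge_atTop 0] with N hN
    exact Real.coe_toNNReal _ hN
  have hS : Tendsto (fun N ↦ (S N : ℝ)) atTop atTop := hst.congr' (hSe.mono fun _ h ↦ h.symm)
  have hcrit' := isLittleO_critical_shift (hξ.iteratedDeriv_two_psi_pos hfin hconst 2).le hs hSe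
    hcrit
  -- The exponential factor is the ratio of the normalizers at times `s N + t₀` and `s N + t k`.
  set c : ι → ℝ := fun k ↦ v k * Real.exp (-(psi ξ P₀ 2 / 2 * h k)) with hc
  set F : ℕ → (ℝ≥0 → ℝ) → ℝ := fun N p ↦ (√(N * Real.exp (psi ξ P₀ 2 * S N)))⁻¹ *
    ∑ k, c k * Real.exp (p (S N + h k)) with hF
  have hFm (N) : Measurable (F N) := by
    refine (Finset.measurable_fun_sum _ fun k _ ↦ ?_).const_mul _
    exact (measurable_pi_apply _).exp.const_mul _
  have key := hξ.tendsto_charFun_row hfin hconst hS hcrit' h c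
    (V := fun N ω ↦ F N (fun T ↦ ξ T ω)) fun N ω ↦ rfl
  -- The weights `c` cancel the growth `exp (ψ(2) (h k + h l) / 2)` of the mixed moments, leaving
  -- the Ornstein–Uhlenbeck covariance.
  have hlim : ∫ ω, Complex.exp ((∑ k, v k * (√(cdf (gaussianReal 0 1) θ) * X (t k) ω) : ℝ) *
        Complex.I) ∂P' = Complex.exp (-(cdf (gaussianReal 0 1) θ *
        ∫ ω, (∑ k, c k * Real.exp (ξ (h k) ω)) ^ 2 ∂P₀ : ℝ) / 2) := by
    have h1 := hX.integral_exp_sum t fun k ↦ v k * √(cdf (gaussianReal 0 1) θ)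
    simp only [mul_assoc (v _)] at h1
    rw [h1]
    congr 4
    have h2 (ω) : (∑ k, c k * Real.exp (ξ (h k) ω)) ^ 2 =
        ∑ k, ∑ l, c k * c l * (Real.exp (ξ (h k) ω) * Real.exp (ξ (h l) ω)) := by
      rw [sq, Finset.sum_mul_sum]
      refine Finset.sum_congr rfl fun k _ ↦ Finset.sum_congr rfl fun l _ ↦ ?_
      ring
    have hint (k l) : Integrable (fun ω ↦ c k * c l *
        (Real.exp (ξ (h k) ω) * Real.exp (ξ (h l) ω))) P₀ :=
      ((hξ.memLp_exp hfin (h k)).integrable_mul (hξ.memLp_exp hfin (h l))).const_mul _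
    simp only [h2]
    rw [integral_finsetSum _ fun k _ ↦ integrable_finsetSum _ fun l _ ↦ hint k l, Finset.mul_sum]
    refine Finset.sum_congr rfl fun k _ ↦ ?_
    rw [integral_finsetSum _ fun l _ ↦ hint k l, Finset.mul_sum]
    refine Finset.sum_congr rfl fun l _ ↦ ?_
    rw [integral_const_mul, hξ.integral_exp_mul_exp hfin, hhk, hhk]
    have h3 := Real.mul_self_sqrt (cdf_nonneg (gaussianReal 0 1) θ)
    have h4 : c k * c l * Real.exp (psi ξ P₀ 2 / 2 * (t k - t₀ + (t l - t₀)) -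
        (psi ξ P₀ 2 / 2 - psi ξ P₀ 1) * |t l - t₀ - (t k - t₀)|) =
        v k * v l * Real.exp (-(psi ξ P₀ 2 / 2 - psi ξ P₀ 1) * |t l - t k|) := by
      simp only [hc, hhk]
      rw [mul_mul_mul_comm, ← Real.exp_add, mul_assoc (v k * v l), ← Real.exp_add,
        sub_sub_sub_cancel_right]
      congr 2
      ring
    rw [h4]
    linear_combination
      (v k * v l * Real.exp (-(psi ξ P₀ 2 / 2 - psi ξ P₀ 1) * |t l - t k|)) * h3
  rw [hlim]
  refine key.congr' ?_
  filter_upwards [hSe, hst.eventually_ge_atTop 0, eventually_gt_atTop 0] with N hSN hge hN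
  have hT (k) : (s N + t k).toNNReal = S N + h k := by
    rw [← Real.toNNReal_add hge (sub_nonneg.2 (ht₀ k))]
    congr 1
    ring
  have hB (k) : √(N * Real.exp (psi ξ P₀ 2 * (s N + t k))) =
      √(N * Real.exp (psi ξ P₀ 2 * S N)) * Real.exp (psi ξ P₀ 2 / 2 * h k) := by
    rw [← Real.sqrt_sq (Real.exp_pos (psi ξ P₀ 2 / 2 * h k)).le,
      ← Real.sqrt_mul (by positivity), mul_assoc, ← Real.exp_nat_mul, ← Real.exp_add, hhk, hSN]
    congr 3
    push_cast
    ring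
  have hmean : ∫ ω, F N (fun T ↦ ξ T ω) ∂P₀ = (√(N * Real.exp (psi ξ P₀ 2 * S N)))⁻¹ *
      ∑ k, c k * ∫ ω, Real.exp (ξ (S N + h k) ω) ∂P₀ := by
    simp only [hF]
    rw [integral_const_mul, integral_finsetSum _ fun k _ ↦
      ((hξ.memLp_exp hfin _).integrable (by norm_num)).const_mul _]
    simp only [integral_const_mul]
  set m := ∫ ω, F N (fun T ↦ ξ T ω) ∂P₀
  have hsum (ω) : (∑ k, v k *
      ((sumProcess ξs s N (t k) ω - ∫ ω', sumProcess ξs s N (t k) ω' ∂P) /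
        √(N * Real.exp (psi ξ P₀ 2 * (s N + t k))))) =
      ∑ i ∈ Finset.range N, (F N (fun T ↦ ξs i T ω) - m) := by
    rw [Finset.sum_sub_distrib, Finset.sum_const, Finset.card_range, nsmul_eq_mul, hmean]
    simp only [hF]
    rw [← Finset.mul_sum, Finset.sum_comm, mul_left_comm, ← mul_sub, Finset.mul_sum _ _ (N : ℝ),
      ← Finset.sum_sub_distrib, Finset.mul_sum]
    refine Finset.sum_congr rfl fun k _ ↦ ?_
    rw [hξs.integral_sumProcess hξ hfin, hT, hB, ← Finset.mul_sum, sumProcess, hT]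
    simp only [hc, Real.exp_neg]
    field_simp
  have hprod (ω) : Complex.exp ((∑ k, v k *
      ((sumProcess ξs s N (t k) ω - ∫ ω', sumProcess ξs s N (t k) ω' ∂P) /
        √(N * Real.exp (psi ξ P₀ 2 * (s N + t k)))) : ℝ) * Complex.I) =
      ∏ i ∈ Finset.range N, (Complex.exp (F N (fun T ↦ ξs i T ω) * Complex.I) *
        Complex.exp (-(m * Complex.I))) := by
    rw [hsum, Complex.ofReal_sum, Finset.sum_mul, Complex.exp_sum]
    refine Finset.prod_congr rfl fun i _ ↦ ?_
    rw [← Complex.exp_add]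
    congr 1
    push_cast
    ring
  simp only [hprod]
  have hFm' := hFm N
  rw [hξs.integral_prod_comp N (f := fun p ↦ Complex.exp (F N p * Complex.I) *
    Complex.exp (-(m * Complex.I))) (by fun_prop), integral_mul_const]

theorem theorem1p3
    {Ω₀ : Type*} [MeasurableSpace Ω₀] (P₀ : Measure Ω₀) [IsProbabilityMeasure P₀]
    (ξ : ℝ≥0 → Ω₀ → ℝ) (hξ : IsLevyProcess ξ P₀)
    (hfin : ∀ u : ℝ, Integrable (fun ω ↦ Real.exp (u * ξ 1 ω)) P₀)
    (hconst : ¬ ∃ a : ℝ, ∀ᵐ ω ∂P₀, ξ 1 ω = a)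
    {Ω : Type*} [MeasurableSpace Ω] (P : Measure Ω) [IsProbabilityMeasure P]
    (ξs : ℕ → ℝ≥0 → Ω → ℝ) (hξs : AreIndepCopies ξs P ξ P₀)
    (s : ℕ → ℝ) (hs : ∀ N, 0 ≤ s N) (θ : ℝ)
    (hcrit : (fun N : ℕ ↦ Real.log N -
        (lambdaTwo ξ P₀ * s N + 2 * θ * √(iteratedDeriv 2 (psi ξ P₀) 2 * s N)))
      =o[atTop] fun N ↦ √(s N))
    {Ω' : Type*} [MeasurableSpace Ω'] (P' : Measure Ω') [IsProbabilityMeasure P']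
    (X : ℝ → Ω' → ℝ) (hX : IsOrnsteinUhlenbeck (psi ξ P₀ 2 / 2 - psi ξ P₀ 1) X P') :
    TendstoFDD (fun N ↦ normalized (sumProcess ξs s N) P) P
      (fun t ω ↦ √(cdf (gaussianReal 0 1) θ) * X t ω) P' := by
  intro d t
  have hsT := tendsto_atTop_of_log_isLittleO hs hcrit
  obtain ⟨t₀, ht₀⟩ : ∃ t₀, ∀ k, t₀ ≤ t k := by
    obtain ⟨t₀, h⟩ := (Set.finite_range t).bddBelow
    exact ⟨t₀, fun k ↦ h (Set.mem_range_self k)⟩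
  set Y : ℕ → Ω → Fin d → ℝ := fun N ω k ↦
    (sumProcess ξs s N (t k) ω - ∫ ω', sumProcess ξs s N (t k) ω' ∂P) /
      √(N * Real.exp (psi ξ P₀ 2 * (s N + t k))) with hYdef
  have hY : TendstoInDistribution Y atTop
      (fun ω k ↦ √(cdf (gaussianReal 0 1) θ) * X (t k) ω) (fun _ ↦ P) P' := by
    refine tendstoInDistribution_of_tendsto_integral_exp (fun N ↦ ?_) ?_ fun v ↦
      tendsto_integral_exp_sumProcess hξ hfin hconst hξs hsT hcrit hX t ht₀ v
    · exact aemeasurable_pi_lambda _ fun k ↦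
        ((hξs.aemeasurable_sumProcess s N (t k)).sub_const _).div_const _
    · exact aemeasurable_pi_lambda _ fun k ↦ (hX.gaussian.aemeasurable (t k)).const_mul _
  -- Slutsky's lemma: multiplying by this deterministic ratio, which tends to 1, restores the true
  -- standard deviation.
  set r : ℕ → Fin d → ℝ := fun N k ↦ √(N * Real.exp (psi ξ P₀ 2 * (s N + t k))) /
    √(Var[sumProcess ξs s N (t k); P]) with hrdef
  have hr : Tendsto r atTop (𝓝 fun _ ↦ 1) := by
    refine tendsto_pi_nhds.2 fun k ↦ ?_
    have hst : Tendsto (fun N ↦ s N + t k) atTop atTop := tendsto_atTop_add_const_right _ _ hsT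
    refine (tendsto_sqrt_div_sqrt_sub hst (hξ.two_mul_psi_one_lt hfin hconst)).congr' ?_
    filter_upwards [hst.eventually_ge_atTop 0] with N hN
    rw [hrdef]
    simp only
    rw [hξs.variance_sumProcess hξ hfin, Real.coe_toNNReal _ hN]
  have hrm : TendstoInMeasure P (fun N (_ : Ω) ↦ r N) atTop fun _ ↦ (fun _ : Fin d ↦ (1 : ℝ)) :=
    tendstoInMeasure_of_tendsto_ae (fun N ↦ aestronglyMeasurable_const) (ae_of_all _ fun _ ↦ hr)
  have hprod := hY.continuous_comp_prodMk_of_tendstoInMeasure_const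
    (g := fun p : (Fin d → ℝ) × (Fin d → ℝ) ↦ p.1 * p.2) (by fun_prop) hrm
    fun N ↦ aemeasurable_const
  refine hprod.congr (fun N ↦ ae_of_all _ fun ω ↦ ?_) (ae_of_all _ fun ω ↦ ?_)
  · ext k
    simp only [Pi.mul_apply, hYdef, hrdef, normalized]
    -- For `N = 0` the sum is empty and both sides are 0.
    rcases Nat.eq_zero_or_pos N with rfl | hN
    · simp [sumProcess]
    · have hN' : (0 : ℝ) < N := by exact_mod_cast hN
      rw [div_mul_div_cancel₀ (Real.sqrt_pos.2 (by positivity)).ne']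
  · ext k
    simp
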